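/- There is an absolute constant $C>0$ such that the following holds. Let $n\ge 1$, let $\Omega\subset\mathbb{R}^n$ be open, and let $V:\mathbb{R}^n\to\mathbb{R}$ be bounded and continuous with $V(x)\ge 0$ for all $x\in\mathbb{R}^n$ and $V(x)>0$ for all $x\in\Omega$. Let $u_0\in L^2(\mathbb{R}^n)$ be real-valued with $\operatorname{supp}u_0\subset\Omega$ (the support being the complement of the largest open set on which $u_0=0$ almost everywhere) and $$J_{0,h}^2:=\int_\Omega\frac{|u_0(x)|^2}{V(x)}\,dx<+\infty .$$ Then the Cauchy problem $$u_t-\Delta u+V(x)u=0\quad(t>0,\ x\in\mathbb{R}^n),\qquad u(0,x)=u_0(x)\quad(x\in\mathbb{R}^n),$$ has a unique solution $u\in C([0,\infty);L^2(\mathbb{R}^n))\cap C^1((0,\infty);L^2(\mathbb{R}^n))\cap C((0,\infty);H^2(\mathbb{R}^n))$, and it satisfies $$(1+t)\,\|u(t,\cdot)\|_{L^2(\mathbb{R}^n)}^2\le C\left(\|u_0\|_{L^2(\mathbb{R}^n)}^2+J_{0,h}^2\right)\qquad(t\ge 0).$$ -/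

import Mathlib

open MeasureTheory Set Topology
open scoped ContDiff BoundedContinuousFunction

noncomputable section

/-- The real Hilbert space `L²(ℝⁿ)` (Lebesgue measure, real-valued functions). -/
abbrev L2 (n : ℕ) : Type :=
  Lp ℝ 2 (volume : Measure (EuclideanSpace ℝ (Fin n)))

/-- The classical partial derivative `∂φ/∂xᵢ`. -/
def partialDeriv {n : ℕ} (i : Fin n) (φ : EuclideanSpace ℝ (Fin n) → ℝ)
    (x : EuclideanSpace ℝ (Fin n)) : ℝ :=
  fderiv ℝ φ x (EuclideanSpace.single i 1)

/-- `g ∈ L²(ℝⁿ)` is the weak `i`-th partial derivative of `f ∈ L²(ℝⁿ)`: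
`∫ f ∂ᵢφ = -∫ g φ` for every `φ ∈ C_c^∞(ℝⁿ)`. -/
def IsWeakPartial {n : ℕ} (i : Fin n) (f g : L2 n) : Prop :=
  ∀ φ : EuclideanSpace ℝ (Fin n) → ℝ, ContDiff ℝ ∞ φ → HasCompactSupport φ →
    ∫ x, f x * partialDeriv i φ x = -∫ x, g x * φ x

theorem integrable_L2_mul {n : ℕ} (f : L2 n) {φ : EuclideanSpace ℝ (Fin n) → ℝ}
    (hc : Continuous φ) (hs : HasCompactSupport φ) : Integrable (fun x => f x * φ x) :=
  (Lp.memLp f).integrable_mul (q := 2) (hc.memLp_of_hasCompactSupport hs)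

theorem continuous_partialDeriv {n : ℕ} (i : Fin n) {φ : EuclideanSpace ℝ (Fin n) → ℝ}
    (h : ContDiff ℝ ∞ φ) : Continuous (partialDeriv i φ) :=
  (h.continuous_fderiv (by simp)).clm_apply continuous_const

theorem hasCompactSupport_partialDeriv {n : ℕ} (i : Fin n)
    {φ : EuclideanSpace ℝ (Fin n) → ℝ} (hs : HasCompactSupport φ) :
    HasCompactSupport (partialDeriv i φ) :=
  hs.fderiv_apply ℝ (EuclideanSpace.single i 1)

theorem IsWeakPartial.zero {n : ℕ} (i : Fin n) : IsWeakPartial i (0 : L2 n) 0 := by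
  intro φ _ _
  have h : ∀ ψ : EuclideanSpace ℝ (Fin n) → ℝ, ∫ x, (0 : L2 n) x * ψ x = 0 := by
    intro ψ
    refine integral_eq_zero_of_ae ?_
    filter_upwards [Lp.coeFn_zero ℝ 2 (volume : Measure (EuclideanSpace ℝ (Fin n)))] with x hx
    rw [hx]
    exact zero_mul _
  rw [h, h, neg_zero]

theorem IsWeakPartial.add {n : ℕ} {i : Fin n} {f g f' g' : L2 n} (h : IsWeakPartial i f g)
    (h' : IsWeakPartial i f' g') : IsWeakPartial i (f + f') (g + g') := by
  intro φ hφ hs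
  have key : ∀ (a b : L2 n) (ψ : EuclideanSpace ℝ (Fin n) → ℝ), Continuous ψ →
      HasCompactSupport ψ →
      ∫ x, (a + b : L2 n) x * ψ x = (∫ x, a x * ψ x) + ∫ x, b x * ψ x := by
    intro a b ψ hc hs
    rw [← integral_add (integrable_L2_mul a hc hs) (integrable_L2_mul b hc hs)]
    refine integral_congr_ae ?_
    filter_upwards [Lp.coeFn_add a b] with x hx
    rw [hx, Pi.add_apply, add_mul]
  rw [key _ _ _ (continuous_partialDeriv i hφ) (hasCompactSupport_partialDeriv i hs),
    key _ _ _ hφ.continuous hs, h φ hφ hs, h' φ hφ hs]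
  ring

theorem IsWeakPartial.smul {n : ℕ} {i : Fin n} {f g : L2 n} (c : ℝ) (h : IsWeakPartial i f g) :
    IsWeakPartial i (c • f) (c • g) := by
  intro φ hφ hs
  have key : ∀ (a : L2 n) (ψ : EuclideanSpace ℝ (Fin n) → ℝ),
      ∫ x, (c • a : L2 n) x * ψ x = c * ∫ x, a x * ψ x := by
    intro a ψ
    rw [← integral_const_mul]
    refine integral_congr_ae ?_
    filter_upwards [Lp.coeFn_smul c a] with x hx
    rw [hx, Pi.smul_apply, smul_eq_mul, mul_assoc]
  rw [key, key, h φ hφ hs]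
  ring

/-- The Sobolev space `H²(ℝⁿ)`. A function is carried along with its (unique) weak first and second
order derivatives, `(f, ∇f, D²f)`, all in `L²(ℝⁿ)`; the norm and topology are inherited from the
product of `L²` spaces, so that the norm is equivalent to the usual `H²` norm
`(‖f‖² + ∑ ‖∂ᵢf‖² + ∑ ‖∂ⱼ∂ᵢf‖²)^{1/2}`. -/
def SobolevH2 (n : ℕ) : Submodule ℝ (L2 n × (Fin n → L2 n) × (Fin n → Fin n → L2 n)) where
  carrier := {p | (∀ i, IsWeakPartial i p.1 (p.2.1 i)) ∧
    ∀ i j, IsWeakPartial j (p.2.1 i) (p.2.2 i j)}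
  zero_mem' := ⟨fun i => .zero i, fun _ j => .zero j⟩
  add_mem' := fun h h' => ⟨fun i => (h.1 i).add (h'.1 i), fun i j => (h.2 i j).add (h'.2 i j)⟩
  smul_mem' := fun c _ h => ⟨fun i => (h.1 i).smul c, fun i j => (h.2 i j).smul c⟩

/-- The inclusion `H²(ℝⁿ) → L²(ℝⁿ)`. -/
def SobolevH2.toL2 {n : ℕ} (w : SobolevH2 n) : L2 n := w.1.1

/-- The Laplacian `Δ : H²(ℝⁿ) → L²(ℝⁿ)`, `Δw = ∑ᵢ ∂ᵢ∂ᵢw`. -/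
def SobolevH2.laplacian {n : ℕ} (w : SobolevH2 n) : L2 n := ∑ i, w.1.2.2 i i

/-- The support of an (almost everywhere defined) function on `ℝⁿ`: the complement of the largest
open set on which it vanishes almost everywhere. -/
def essSupport {n : ℕ} (f : EuclideanSpace ℝ (Fin n) → ℝ) : Set (EuclideanSpace ℝ (Fin n)) :=
  {x | ∀ U ∈ 𝓝 x, ¬ ∀ᵐ y ∂(volume.restrict U), f y = 0}

/-- `u : [0, ∞) → L²(ℝⁿ)` (the values at negative times are irrelevant) is a solution of
`u_t - Δu + V u = 0`, `u(0) = u₀` in the class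
`C([0,∞); L²) ∩ C¹((0,∞); L²) ∩ C((0,∞); H²)`. -/
structure IsHeatSolution {n : ℕ} (V : EuclideanSpace ℝ (Fin n) →ᵇ ℝ) (u₀ : L2 n)
    (u : ℝ → L2 n) : Prop where
  continuousOn : ContinuousOn u (Ici 0)
  contDiffOn : ContDiffOn ℝ 1 u (Ioi 0)
  /-- `u ∈ C((0,∞); H²)`, and the equation holds in `L²` at each positive time. -/
  equation : ∃ w : ℝ → SobolevH2 n, ContinuousOn w (Ioi 0) ∧ ∀ t, 0 < t →
    SobolevH2.toL2 (w t) = u t ∧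
      ∀ᵐ x, deriv u t x - SobolevH2.laplacian (w t) x + V x * u t x = 0
  initial : u 0 = u₀

end

open Filter

/-! The decay uses only that the flow is `u' = -Au` with `A = -Δ + V` symmetric and nonnegative,
together with the bound `⟨Vf, f⟩ ≤ ⟨Af, f⟩`. Symmetry makes `⟨u(p), u(q)⟩` depend on `p + q` alone,
so `‖u(t)‖² = ⟨u₀, u(2t)⟩`. As `u₀` lives on `Ω`, completing the square with weight `V` gives, for
every `η > 0`, `2⟨u₀, u(2t)⟩ ≤ J/η + η⟨V u(2t), u(2t)⟩ ≤ J/η - η⟨u'(2t), u(2t)⟩`, where `J` is the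
weighted integral of `u₀`. The dissipation `-⟨u', u⟩` is nonincreasing, hence at time `2t` it is at
most its averages over `[t, 2t]`, and `-2t⟨u'(2t), u(2t)⟩ ≤ ‖u(t)‖²`. The choice `η = 2t` lets this
term be absorbed on the left: `t‖u(t)‖² ≤ J/2`. Adding `‖u(t)‖² ≤ ‖u₀‖²` gives the theorem with `C =
1`, in every dimension. The carriers are `inner_eq_norm_sq_midpoint`, `neg_inner_deriv_self_le`,
`mul_norm_sq_le_of_inner_initial_le` and `two_mul_inner_le_weighted`.

Existence avoids unbounded operators. For `c = ‖V‖ + 1` the resolvent `(c - Δ)⁻¹` is a Fourier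
multiplier, and a Neumann series turns it into the bounded, positive, injective operator `R = (c - Δ
+ V)⁻¹` (`exists_perturbed_resolvent`). The continuous functional calculus applied to `r ↦
exp(-t/r)` on the spectrum of `R` yields the semigroup generated by `-R⁻¹`
(`exists_semigroup_orbit`); multiplying by `exp(ct)` and taking real parts solves the equation.
Uniqueness is the monotonicity of the norm applied to a difference of solutions. The symmetry of `Δ`
on `H²` is obtained on the Fourier side, where a derivative is multiplication by an imaginary
symbol. -/

/-! ### The kernel `exp(-t/r)` and its time derivative, uniformly in `r ≥ 0` -/

theorem expNegInvGlue_div_of_pos {r t : ℝ} (hr : 0 < r) (ht : 0 < t) :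
    expNegInvGlue (r / t) = Real.exp (-(t / r)) := by
  rw [expNegInvGlue, if_neg (not_le.2 (div_pos hr ht)), inv_div]

theorem continuous_inv_mul_expNegInvGlue_div {t : ℝ} (ht : 0 < t) :
    Continuous fun r : ℝ => r⁻¹ * expNegInvGlue (r / t) := by
  have h := (expNegInvGlue.contDiff_polynomial_eval_inv_mul (n := 0) Polynomial.X).continuous
  have h2 : Continuous fun r : ℝ => t⁻¹ * ((Polynomial.X : Polynomial ℝ).eval (r / t)⁻¹ *
      expNegInvGlue (r / t)) :=
    continuous_const.mul (h.comp (continuous_id.div_const t))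
  refine h2.congr fun r => ?_
  rw [Polynomial.eval_X, inv_div]
  field_simp

/-- This is `s²/2 ≤ exp s` at `s = t/r`. It bounds the second time derivative of the kernel
independently of `r`. -/
theorem sq_inv_mul_exp_le {r t : ℝ} (hr : 0 < r) (ht : 0 < t) :
    (r⁻¹) ^ 2 * Real.exp (-(t / r)) ≤ 2 / t ^ 2 := by
  have h := Real.quadratic_le_exp_of_nonneg (div_pos ht hr).le
  have h1 : (t / r) ^ 2 / 2 ≤ Real.exp (t / r) := by
    have := div_pos ht hr
    linarith
  rw [Real.exp_neg, ← div_eq_mul_inv, div_le_div_iff₀ (Real.exp_pos _) (by positivity)]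
  calc r⁻¹ ^ 2 * t ^ 2 = 2 * ((t / r) ^ 2 / 2) := by field_simp
    _ ≤ _ := by gcongr

/-- A curve of continuous functions that is pointwise differentiable, with pointwise derivative a
continuous curve, is differentiable for the uniform norm. -/
theorem ContinuousMap.hasDerivAt_of_forall {K : Type*} [TopologicalSpace K] [CompactSpace K]
    {F G : ℝ → C(K, ℝ)} {s : Set ℝ} (hs : IsOpen s)
    (hF : ∀ t ∈ s, ∀ x, HasDerivAt (fun τ => F τ x) (G t x) t) (hG : ContinuousOn G s)
    {t : ℝ} (ht : t ∈ s) : HasDerivAt F (G t) t := by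
  rw [hasDerivAt_iff_isLittleO, Asymptotics.isLittleO_iff]
  intro ε hε
  have hGt := (hG.continuousAt (hs.mem_nhds ht))
  obtain ⟨δ, hδ, hball⟩ := Metric.mem_nhds_iff.1
    (Filter.inter_mem (hs.mem_nhds ht) (hGt (Metric.closedBall_mem_nhds _ hε)))
  filter_upwards [Metric.ball_mem_nhds t hδ] with τ hτ
  rw [ContinuousMap.norm_le _ (by positivity)]
  intro x
  -- The mean value inequality for `F σ x - σ G t x` has a constant that does not depend on `x`,
  -- which makes the estimate uniform.
  have key := (convex_ball t δ).norm_image_sub_le_of_norm_hasDerivWithin_le (𝕜 := ℝ)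
    (f := fun σ => F σ x - σ * G t x) (f' := fun σ => G σ x - G t x) (C := ε)
    (fun σ hσ => by
      have h := (hF σ (hball hσ).1 x).sub ((hasDerivAt_id σ).mul_const (G t x))
      rw [one_mul] at h
      exact h.hasDerivWithinAt)
    (fun σ hσ => by
      have h := (hball hσ).2
      rw [Set.mem_preimage, Metric.mem_closedBall, dist_eq_norm] at h
      exact ((G σ - G t).norm_coe_le_norm x).trans h)
    (Metric.mem_ball_self hδ) hτ
  refine le_trans (le_of_eq ?_) key
  simp only [ContinuousMap.sub_apply, ContinuousMap.smul_apply, smul_eq_mul]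
  congr 1
  ring

section Kernel

variable (K : Set ℝ)

/-- The function `r ↦ exp (-t / r)`, extended by `0` at `r = 0`. -/
noncomputable def expNegDivMap (t : ℝ) : C(K, ℝ) where
  toFun r := expNegInvGlue (r / t)
  continuous_toFun := ((expNegInvGlue.contDiff (n := 0)).continuous).comp
    (continuous_subtype_val.div_const t)

open Classical in
/-- The function `r ↦ exp (-t / r) / r` for `t > 0`, extended by `0` at `r = 0`. -/
noncomputable def invMulExpNegDivMap (t : ℝ) : C(K, ℝ) :=
  if ht : 0 < t then
    ⟨fun r => (r : ℝ)⁻¹ * expNegInvGlue (r / t),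
      (continuous_inv_mul_expNegInvGlue_div ht).comp continuous_subtype_val⟩
  else 0

variable {K}

theorem expNegDivMap_apply (t : ℝ) (r : K) :
    expNegDivMap K t r = expNegInvGlue (r / t) := rfl

theorem invMulExpNegDivMap_apply {t : ℝ} (ht : 0 < t) (r : K) :
    invMulExpNegDivMap K t r = (r : ℝ)⁻¹ * expNegInvGlue (r / t) := by
  rw [invMulExpNegDivMap, dif_pos ht]; rfl

theorem hasDerivAt_expNegDivMap_apply (hK : ∀ r ∈ K, 0 ≤ r) {t : ℝ} (ht : 0 < t) (r : K) :
    HasDerivAt (fun τ => expNegDivMap K τ r) ((-invMulExpNegDivMap K t) r) t := by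
  rw [ContinuousMap.neg_apply, invMulExpNegDivMap_apply ht]
  rcases (hK r r.2).eq_or_lt with h | h
  · simp only [expNegDivMap_apply, ← h, zero_div, expNegInvGlue.zero, inv_zero, zero_mul, neg_zero]
    exact hasDerivAt_const _ _
  · rw [expNegInvGlue_div_of_pos h ht]
    have h1 : HasDerivAt (fun τ : ℝ => Real.exp (-(τ / r))) (Real.exp (-(t / r)) * -(1 / r)) t :=
      (((hasDerivAt_id t).div_const (r : ℝ)).neg).exp
    refine (h1.congr_deriv (by ring)).congr_of_eventuallyEq ?_
    filter_upwards [lt_mem_nhds ht] with τ hτ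
    rw [expNegDivMap_apply, expNegInvGlue_div_of_pos h hτ]

theorem continuousOn_invMulExpNegDivMap [CompactSpace K] (hK : ∀ r ∈ K, 0 ≤ r) :
    ContinuousOn (invMulExpNegDivMap K) (Ioi 0) := by
  intro t ht
  rw [mem_Ioi] at ht
  refine ContinuousAt.continuousWithinAt ?_
  have ht2 : 0 < t / 2 := by positivity
  -- Away from `t = 0` the time derivative `-r⁻² exp(-t/r)` is bounded uniformly in `r`, so the
  -- curve is locally Lipschitz in the uniform norm.
  have hlip : LipschitzOnWith (Real.toNNReal (2 / (t / 2) ^ 2)) (invMulExpNegDivMap K)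
      (Ioi (t / 2)) := by
    refine LipschitzOnWith.of_dist_le_mul fun σ hσ τ hτ => ?_
    rw [Real.coe_toNNReal _ (by positivity), ContinuousMap.dist_le (by positivity)]
    intro r
    rw [dist_eq_norm, dist_eq_norm]
    have hmem : ∀ ρ ∈ Ioi (t / 2), 0 < ρ := fun ρ hρ => ht2.trans hρ
    rw [invMulExpNegDivMap_apply (hmem σ hσ), invMulExpNegDivMap_apply (hmem τ hτ)]
    rcases (hK r r.2).eq_or_lt with h | h
    · simp only [← h, inv_zero, zero_mul, sub_self, norm_zero]
      positivity
    refine (convex_Ioi (t / 2)).norm_image_sub_le_of_norm_hasDerivWithin_le (𝕜 := ℝ)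
      (f := fun ρ => (r : ℝ)⁻¹ * expNegInvGlue (r / ρ))
      (f' := fun ρ => -((r : ℝ)⁻¹ ^ 2 * Real.exp (-(ρ / r)))) (fun ρ hρ => ?_) (fun ρ hρ => ?_)
      hτ hσ
    · have h1 := (hasDerivAt_expNegDivMap_apply hK (hmem ρ hρ) r).const_mul (r : ℝ)⁻¹
      rw [ContinuousMap.neg_apply, invMulExpNegDivMap_apply (hmem ρ hρ),
        expNegInvGlue_div_of_pos h (hmem ρ hρ)] at h1
      refine (h1.congr_deriv ?_).hasDerivWithinAt
      ring
    · rw [norm_neg, Real.norm_of_nonneg (by positivity)]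
      refine (sq_inv_mul_exp_le h (hmem ρ hρ)).trans ?_
      have : t / 2 ≤ ρ := le_of_lt hρ
      gcongr
  exact hlip.continuousOn.continuousAt (Ioi_mem_nhds (by linarith))

theorem norm_expNegDivMap_le [CompactSpace K] (t : ℝ) :
    ‖expNegDivMap K t‖ ≤ 1 := by
  rw [ContinuousMap.norm_le _ zero_le_one]
  intro r
  rw [expNegDivMap_apply, Real.norm_of_nonneg (expNegInvGlue.nonneg _), expNegInvGlue]
  split_ifs with h
  · exact zero_le_one
  · exact Real.exp_le_one_iff.2 (neg_nonpos.2 (inv_nonneg.2 (not_le.1 h).le))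

/-- From `1 - s ≤ exp(-s) ≤ 1` at `s = t/r`. It gives convergence to the initial value on the range
of `R`. -/
theorem norm_expNegDivMap_mul_id_sub_id_le [CompactSpace K] (hK : ∀ r ∈ K, 0 ≤ r) {t : ℝ}
    (ht : 0 < t) :
    ‖expNegDivMap K t * (ContinuousMap.id ℝ).restrict K - (ContinuousMap.id ℝ).restrict K‖ ≤ t := by
  rw [ContinuousMap.norm_le _ ht.le]
  intro r
  simp only [ContinuousMap.sub_apply, ContinuousMap.mul_apply, expNegDivMap_apply,
    ContinuousMap.restrict_apply, ContinuousMap.id_apply]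
  rcases (hK r r.2).eq_or_lt with h | h
  · simp [← h, ht.le]
  · rw [expNegInvGlue_div_of_pos h ht, Real.norm_eq_abs, abs_le]
    have h1 := Real.add_one_le_exp (-(t / r))
    have h2 : Real.exp (-(t / r)) ≤ 1 := Real.exp_le_one_iff.2 (by
      have := div_pos ht h
      linarith)
    have h3 : t / r * r = t := div_mul_cancel₀ _ h.ne'
    constructor <;> nlinarith

/-- Under the functional calculus this becomes `R v = -u`, the evolution equation without the
unbounded `R⁻¹`. -/
theorem id_mul_invMulExpNegDivMap (hK : ∀ r ∈ K, 0 ≤ r) {t : ℝ} (ht : 0 < t) :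
    (ContinuousMap.id ℝ).restrict K * invMulExpNegDivMap K t = expNegDivMap K t := by
  ext r
  rw [ContinuousMap.mul_apply, invMulExpNegDivMap_apply ht, expNegDivMap_apply]
  simp only [ContinuousMap.restrict_apply, ContinuousMap.id_apply]
  rcases (hK r r.2).eq_or_lt with h | h
  · simp [← h]
  · field_simp

end Kernel

/-! ### Semigroup from the functional calculus -/

/-- The analytic semigroup generated by `-R⁻¹`, for a bounded, positive and injective operator `R`
on a Hilbert space. -/
theorem exists_semigroup_orbit {H : Type*} [NormedAddCommGroup H] [InnerProductSpace ℂ H]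
    [CompleteSpace H] {R : H →L[ℂ] H} (hR : R.IsPositive) (hinj : Function.Injective R) (x₀ : H) :
    ∃ u v : ℝ → H, ContinuousOn u (Ici 0) ∧ u 0 = x₀ ∧ ContinuousOn v (Ioi 0) ∧
      ∀ t, 0 < t → HasDerivAt u (v t) t ∧ R (v t) = -u t := by
  have hsa : IsSelfAdjoint R := hR.isSelfAdjoint
  have h0 : 0 ≤ R := (ContinuousLinearMap.nonneg_iff_isPositive R).2 hR
  have hK : ∀ r ∈ spectrum ℝ R, 0 ≤ r := fun r hr => spectrum_nonneg_of_nonneg h0 hr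
  have : CompactSpace (spectrum ℝ R) := isCompact_iff_compactSpace.1 (spectrum.isCompact (𝕜 := ℝ) R)
  let Φ := cfcHom (R := ℝ) hsa
  have hΦid : Φ ((ContinuousMap.id ℝ).restrict (spectrum ℝ R)) = R := cfcHom_id hsa
  have hΦn : ∀ f, ‖Φ f‖ = ‖f‖ := fun f => norm_cfcHom R f hsa
  let Ψ : C(spectrum ℝ R, ℝ) →L[ℝ] H :=
    LinearMap.mkContinuous
      { toFun := fun f => Φ f x₀
        map_add' := fun f g => by rw [map_add]; rfl
        map_smul' := fun c f => by rw [map_smul]; rfl } ‖x₀‖ fun f => by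
          have := (Φ f).le_opNorm x₀
          rw [hΦn, mul_comm] at this
          exact this
  have hΨ : ∀ f, Ψ f = Φ f x₀ := fun f => rfl
  have hGc : ContinuousOn (fun t => -invMulExpNegDivMap (spectrum ℝ R) t) (Ioi 0) :=
    (continuousOn_invMulExpNegDivMap hK).neg
  have hd : ∀ t, 0 < t → HasDerivAt (fun τ => Ψ (expNegDivMap (spectrum ℝ R) τ))
      (Ψ (-invMulExpNegDivMap (spectrum ℝ R) t)) t := fun t ht =>
    Ψ.hasFDerivAt.comp_hasDerivAt t (ContinuousMap.hasDerivAt_of_forall isOpen_Ioi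
      (fun τ hτ r => hasDerivAt_expNegDivMap_apply hK hτ r) hGc ht)
  -- The orthogonal complement of the range is the kernel of `R* = R`, which is trivial.
  have hdense : DenseRange R := by
    have h1 : R.rangeᗮ = ⊥ := by
      rw [ContinuousLinearMap.orthogonal_range, hsa.adjoint_eq]
      exact LinearMap.ker_eq_bot.2 hinj
    have h2 := (Submodule.topologicalClosure_eq_top_iff (K := R.range)).2 h1
    intro x
    have h3 : x ∈ R.range.topologicalClosure := h2 ▸ Submodule.mem_top
    exact h3
  -- Approximate `x₀` by some `R z`: the kernel acts as a contraction on the error and moves `R z`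
  -- by at most `t‖z‖`.
  have hlim : Tendsto (fun t => Ψ (expNegDivMap (spectrum ℝ R) t)) (𝓝[>] 0) (𝓝 x₀) := by
    rw [Metric.tendsto_nhds]
    intro ε hε
    obtain ⟨z, hz⟩ := hdense.exists_dist_lt x₀ (ε := ε / 4) (by positivity)
    have hz' : ‖x₀ - R z‖ < ε / 4 := by rwa [dist_eq_norm] at hz
    have hδ : 0 < ε / (2 * (‖z‖ + 1)) := by positivity
    filter_upwards [Ioo_mem_nhdsGT hδ] with t ht
    set f := expNegDivMap (spectrum ℝ R) t
    have e1 : ‖Φ f (x₀ - R z)‖ ≤ ‖x₀ - R z‖ := by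
      refine ((Φ f).le_opNorm _).trans ?_
      rw [hΦn]
      exact mul_le_of_le_one_left (norm_nonneg _) (norm_expNegDivMap_le t)
    have e2 : ‖Φ f (R z) - R z‖ ≤ t * ‖z‖ := by
      have : Φ f (R z) - R z = Φ (f * (ContinuousMap.id ℝ).restrict (spectrum ℝ R) -
          (ContinuousMap.id ℝ).restrict (spectrum ℝ R)) z := by
        rw [map_sub, map_mul, hΦid]; rfl
      rw [this]
      refine ((Φ _).le_opNorm _).trans ?_
      rw [hΦn]
      exact mul_le_mul_of_nonneg_right (norm_expNegDivMap_mul_id_sub_id_le hK ht.1) (norm_nonneg _)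
    have e3 : t * ‖z‖ ≤ ε / 2 := by
      have h1 : t * (2 * (‖z‖ + 1)) < ε := (lt_div_iff₀ (by positivity)).1 ht.2
      nlinarith [ht.1, norm_nonneg z]
    rw [dist_eq_norm, hΨ]
    have e4 : Φ f x₀ - x₀ = Φ f (x₀ - R z) + (Φ f (R z) - R z) - (x₀ - R z) := by
      rw [map_sub]; abel
    rw [e4]
    calc _ ≤ ‖Φ f (x₀ - R z)‖ + ‖Φ f (R z) - R z‖ + ‖x₀ - R z‖ :=
          (norm_sub_le _ _).trans (add_le_add_left (norm_add_le _ _) _)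
      _ < ε := by linarith
  refine ⟨fun t => if t ≤ 0 then x₀ else Ψ (expNegDivMap (spectrum ℝ R) t),
    fun t => Ψ (-invMulExpNegDivMap (spectrum ℝ R) t), ?_, if_pos le_rfl,
    Ψ.continuous.comp_continuousOn hGc, ?_⟩
  · have hev : ∀ t : ℝ, 0 < t → (fun t => if t ≤ 0 then x₀ else
        Ψ (expNegDivMap (spectrum ℝ R) t)) =ᶠ[𝓝 t] fun t => Ψ (expNegDivMap (spectrum ℝ R) t) := by
      intro t ht
      filter_upwards [lt_mem_nhds ht] with τ hτ using if_neg (not_le.2 hτ)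
    intro t ht
    rcases (mem_Ici.1 ht).eq_or_lt with rfl | ht
    · rw [← continuousWithinAt_Ioi_iff_Ici, ContinuousWithinAt, if_pos le_rfl]
      refine hlim.congr' ?_
      filter_upwards [self_mem_nhdsWithin] with τ hτ using (if_neg (not_le.2 hτ)).symm
    · exact ((hd t ht).continuousAt.congr (hev t ht).symm).continuousWithinAt
  · intro t ht
    constructor
    · refine (hd t ht).congr_of_eventuallyEq ?_
      filter_upwards [lt_mem_nhds ht] with τ hτ using if_neg (not_le.2 hτ)
    · beta_reduce
      rw [if_neg (not_le.2 ht), map_neg, map_neg, hΨ, hΨ, ← id_mul_invMulExpNegDivMap hK ht,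
        map_mul, hΦid]
      rfl

/-! ### Decay for abstract symmetric flows -/

section SymmetricFlow

variable {H : Type*} [NormedAddCommGroup H] [InnerProductSpace ℝ H] {u u' : ℝ → H}

/-- By symmetry the derivative of `σ ↦ ⟨u(t + σ), u(t - σ)⟩` vanishes, so it keeps its value at `σ =
0`. -/
theorem inner_add_sub_eq_norm_sq (hc : ContinuousOn u (Ici 0))
    (hd : ∀ t, 0 < t → HasDerivAt u (u' t) t)
    (hs : ∀ s t, 0 < s → 0 < t → inner ℝ (u' s) (u t) = inner ℝ (u s) (u' t))
    {t s : ℝ} (hs0 : 0 ≤ s) (hst : s ≤ t) :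
    inner ℝ (u (t + s)) (u (t - s)) = ‖u t‖ ^ 2 := by
  rcases hs0.eq_or_lt with rfl | hs0
  · rw [add_zero, sub_zero, real_inner_self_eq_norm_sq]
  have hcont : ContinuousOn (fun σ => inner ℝ (u (t + σ)) (u (t - σ))) (Icc 0 s) := by
    refine ContinuousOn.inner (𝕜 := ℝ) (hc.comp (by fun_prop) fun σ hσ => ?_)
      (hc.comp (by fun_prop) fun σ hσ => ?_)
    · exact mem_Ici.2 (by linarith [hσ.1])
    · exact mem_Ici.2 (by linarith [hσ.2])
  have hderiv : ∀ σ ∈ Ioo 0 s, HasDerivAt (fun σ => inner ℝ (u (t + σ)) (u (t - σ))) 0 σ := by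
    intro σ hσ
    have hp : 0 < t + σ := by linarith [hσ.1]
    have hm : 0 < t - σ := by linarith [hσ.2]
    have h1 : HasDerivAt (fun σ => u (t + σ)) (u' (t + σ)) σ := by
      have := (hd _ hp).scomp σ ((hasDerivAt_id σ).const_add t)
      rwa [one_smul] at this
    have h2 : HasDerivAt (fun σ => u (t - σ)) (-u' (t - σ)) σ := by
      have := (hd _ hm).scomp σ ((hasDerivAt_id σ).const_sub t)
      rwa [neg_one_smul] at this
    refine (h1.inner ℝ h2).congr_deriv ?_
    rw [inner_neg_right, hs _ _ hp hm]
    ring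
  obtain ⟨c, hcm, hc'⟩ := exists_hasDerivAt_eq_slope _ _ hs0 hcont hderiv
  have h0 := (div_eq_zero_iff.1 hc'.symm).resolve_right (by linarith)
  rw [add_zero, sub_zero, real_inner_self_eq_norm_sq] at h0
  linarith

theorem inner_eq_norm_sq_midpoint (hc : ContinuousOn u (Ici 0))
    (hd : ∀ t, 0 < t → HasDerivAt u (u' t) t)
    (hs : ∀ s t, 0 < s → 0 < t → inner ℝ (u' s) (u t) = inner ℝ (u s) (u' t))
    {p q : ℝ} (hp : 0 ≤ p) (hq : 0 ≤ q) :
    inner ℝ (u p) (u q) = ‖u ((p + q) / 2)‖ ^ 2 := by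
  wlog h : q ≤ p generalizing p q
  · rw [real_inner_comm, add_comm]
    exact this hq hp (le_of_not_ge h)
  have := inner_add_sub_eq_norm_sq hc hd hs (t := (p + q) / 2) (s := (p - q) / 2)
    (by linarith) (by linarith)
  rwa [show (p + q) / 2 + (p - q) / 2 = p by ring,
    show (p + q) / 2 - (p - q) / 2 = q by ring] at this

theorem hasDerivAt_norm_sq_half (hd : ∀ t, 0 < t → HasDerivAt u (u' t) t) {σ : ℝ} (hσ : 0 < σ) :
    HasDerivAt (fun σ => ‖u (σ / 2)‖ ^ 2) (inner ℝ (u' (σ / 2)) (u (σ / 2))) σ := by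
  have h1 : HasDerivAt (fun σ => u (σ / 2)) ((1 / 2 : ℝ) • u' (σ / 2)) σ :=
    (hd (σ / 2) (half_pos hσ)).scomp σ ((hasDerivAt_id σ).div_const 2)
  refine h1.norm_sq.congr_deriv ?_
  rw [inner_smul_right, real_inner_comm]
  ring

theorem inner_deriv_eq_midpoint (hc : ContinuousOn u (Ici 0))
    (hd : ∀ t, 0 < t → HasDerivAt u (u' t) t)
    (hs : ∀ s t, 0 < s → 0 < t → inner ℝ (u' s) (u t) = inner ℝ (u s) (u' t))
    {p q : ℝ} (hp : 0 < p) (hq : 0 < q) :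
    inner ℝ (u' p) (u q) = inner ℝ (u' ((p + q) / 2)) (u ((p + q) / 2)) := by
  have h1 : HasDerivAt (fun r => inner ℝ (u r) (u q)) (inner ℝ (u' p) (u q)) p := by
    refine ((hd p hp).inner ℝ (hasDerivAt_const p (u q))).congr_deriv ?_
    rw [inner_zero_right, zero_add]
  have h2 : HasDerivAt (fun r => ‖u ((r + q) / 2)‖ ^ 2)
      (inner ℝ (u' ((p + q) / 2)) (u ((p + q) / 2))) p := by
    have := (hasDerivAt_norm_sq_half hd (add_pos hp hq)).comp p ((hasDerivAt_id p).add_const q)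
    rwa [mul_one] at this
  refine h1.unique (h2.congr_of_eventuallyEq ?_)
  filter_upwards [lt_mem_nhds hp] with r hr using inner_eq_norm_sq_midpoint hc hd hs hr.le hq.le

/-- The derivative of `⟨u', u⟩` is `2‖u'‖² ≥ 0`. -/
theorem monotoneOn_inner_deriv_self (hc : ContinuousOn u (Ici 0))
    (hd : ∀ t, 0 < t → HasDerivAt u (u' t) t)
    (hs : ∀ s t, 0 < s → 0 < t → inner ℝ (u' s) (u t) = inner ℝ (u s) (u' t)) :
    MonotoneOn (fun t => inner ℝ (u' t) (u t)) (Ioi 0) := by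
  have key : ∀ p, 0 < p → HasDerivAt (fun t => inner ℝ (u' t) (u t)) (2 * ‖u' p‖ ^ 2) p := by
    intro p hp
    -- Near `p`, the midpoint identity rewrites `⟨u'(t), u(t)⟩` as `⟨u'(p), u(2t - p)⟩`, so no
    -- second derivative of `u` is needed.
    have h1 : HasDerivAt (fun t => u (2 * t - p)) ((2 : ℝ) • u' p) p := by
      have h2 : HasDerivAt (fun t : ℝ => 2 * t - p) 2 p := by
        simpa using ((hasDerivAt_id p).const_mul 2).sub_const p
      have h3 : HasDerivAt u (u' p) ((fun t : ℝ => 2 * t - p) p) := by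
        beta_reduce
        rw [show 2 * p - p = p by ring]
        exact hd p hp
      exact HasDerivAt.scomp (h := fun t : ℝ => 2 * t - p) p h3 h2
    have h4 : HasDerivAt (fun t => inner ℝ (u' p) (u (2 * t - p))) (2 * ‖u' p‖ ^ 2) p := by
      refine ((hasDerivAt_const p (u' p)).inner ℝ h1).congr_deriv ?_
      rw [inner_zero_left, add_zero, inner_smul_right, real_inner_self_eq_norm_sq]
    refine h4.congr_of_eventuallyEq ?_
    filter_upwards [lt_mem_nhds (show p / 2 < p by linarith)] with t ht
    rw [inner_deriv_eq_midpoint hc hd hs hp (by linarith),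
      show (p + (2 * t - p)) / 2 = t by ring]
  refine monotoneOn_of_deriv_nonneg (convex_Ioi 0)
    (fun p hp => (key p hp).continuousAt.continuousWithinAt) ?_ ?_
  · rw [interior_Ioi]
    exact fun p hp => (key p hp).differentiableAt.differentiableWithinAt
  · rw [interior_Ioi]
    intro p hp
    rw [(key p hp).deriv]
    positivity

/-- The mean value theorem writes `‖u(2t)‖² - ‖u(t)‖²` as `2t⟨u', u⟩` at a time in `(t, 2t)`;
monotonicity replaces that time by `2t`, and `‖u(2t)‖²` is dropped. -/
theorem neg_inner_deriv_self_le (hc : ContinuousOn u (Ici 0))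
    (hd : ∀ t, 0 < t → HasDerivAt u (u' t) t)
    (hs : ∀ s t, 0 < s → 0 < t → inner ℝ (u' s) (u t) = inner ℝ (u s) (u' t))
    {t : ℝ} (ht : 0 < t) :
    2 * t * -inner ℝ (u' (2 * t)) (u (2 * t)) ≤ ‖u t‖ ^ 2 := by
  obtain ⟨c, hcm, hc'⟩ := exists_hasDerivAt_eq_slope (fun σ => ‖u (σ / 2)‖ ^ 2)
    (fun σ => inner ℝ (u' (σ / 2)) (u (σ / 2))) (show 2 * t < 4 * t by linarith)
    (fun σ hσ => (hasDerivAt_norm_sq_half hd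
      (by linarith [hσ.1])).continuousAt.continuousWithinAt)
    (fun σ hσ => hasDerivAt_norm_sq_half hd (by linarith [hσ.1]))
  have hmono := monotoneOn_inner_deriv_self hc hd hs (mem_Ioi.2 (by linarith [hcm.1] : 0 < c / 2))
    (mem_Ioi.2 (by linarith : 0 < 2 * t)) (by linarith [hcm.2])
  rw [eq_div_iff (by linarith), show 4 * t / 2 = 2 * t by ring,
    show 2 * t / 2 = t by ring] at hc'
  beta_reduce at hmono
  nlinarith [sq_nonneg ‖u (2 * t)‖]

theorem mul_norm_sq_le_of_inner_initial_le (hc : ContinuousOn u (Ici 0))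
    (hd : ∀ t, 0 < t → HasDerivAt u (u' t) t)
    (hs : ∀ s t, 0 < s → 0 < t → inner ℝ (u' s) (u t) = inner ℝ (u s) (u' t)) {J : ℝ}
    (hJ : ∀ t η, 0 < t → 0 < η → 2 * inner ℝ (u 0) (u t) ≤ J / η + η * -inner ℝ (u' t) (u t))
    {t : ℝ} (ht : 0 < t) : t * ‖u t‖ ^ 2 ≤ J / 2 := by
  have h1 := inner_eq_norm_sq_midpoint hc hd hs le_rfl (show 0 ≤ 2 * t by linarith)
  rw [show (0 + 2 * t) / 2 = t by ring] at h1
  -- Time `2t` turns the left side into `2‖u(t)‖²`; `η = 2t` makes the dissipation term at most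
  -- `‖u(t)‖²`.
  have h2 := hJ (2 * t) (2 * t) (by linarith) (by linarith)
  have h3 := neg_inner_deriv_self_le hc hd hs ht
  have h4 : ‖u t‖ ^ 2 ≤ J / (2 * t) := by linarith
  rw [le_div_iff₀ (by linarith)] at h4
  linarith

theorem antitoneOn_norm_sq (hc : ContinuousOn u (Ici 0))
    (hd : ∀ t, 0 < t → HasDerivAt u (u' t) t) (hn : ∀ t, 0 < t → inner ℝ (u' t) (u t) ≤ 0) :
    AntitoneOn (fun t => ‖u t‖ ^ 2) (Ici 0) := by
  refine antitoneOn_of_deriv_nonpos (convex_Ici 0) (hc.norm.pow 2) ?_ ?_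
  · rw [interior_Ici]
    exact fun t ht => (hd t ht).norm_sq.differentiableAt.differentiableWithinAt
  · rw [interior_Ici]
    intro t ht
    rw [(hd t ht).norm_sq.deriv, real_inner_comm]
    linarith [hn t ht]

end SymmetricFlow

/-! ### Multiplication operators on `L²` -/

section MulLp

variable {α : Type*} [TopologicalSpace α] [MeasurableSpace α] [BorelSpace α]
  {μ : Measure α} {𝕜 : Type*} [RCLike 𝕜]

/-- Multiplication by a bounded continuous function, as an operator on `L²`. -/
noncomputable def mulLp (μ : Measure α) (g : α →ᵇ 𝕜) : Lp 𝕜 2 μ →L[𝕜] Lp 𝕜 2 μ :=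
  LinearMap.mkContinuous
    { toFun := fun f => (g.memLp_top (μ := μ)).toLp g • f
      map_add' := fun f f' => Lp.add_smul _ f f'
      map_smul' := fun c f => (Lp.smul_comm c _ f).symm } ‖g‖ fun f => by
    refine (Lp.norm_smul_le _ f).trans (mul_le_mul_of_nonneg_right ?_ (norm_nonneg _))
    rw [Lp.norm_toLp]
    refine ENNReal.toReal_le_of_le_ofReal (norm_nonneg _) ?_
    rw [eLpNorm_exponent_top]
    exact eLpNormEssSup_le_of_ae_bound (Eventually.of_forall g.norm_coe_le_norm)

theorem mulLp_ae (g : α →ᵇ 𝕜) (f : Lp 𝕜 2 μ) : mulLp μ g f =ᵐ[μ] fun x => g x * f x := by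
  have h : mulLp μ g f = ((g.memLp_top (μ := μ)).toLp g • f : Lp 𝕜 2 μ) := rfl
  rw [h]
  filter_upwards [Lp.coeFn_lpSMul (r := 2) ((g.memLp_top (μ := μ)).toLp g) f,
    (g.memLp_top (μ := μ)).coeFn_toLp] with x h1 h2
  rw [h1, Pi.smul_apply', h2, smul_eq_mul]

theorem norm_mulLp_le (g : α →ᵇ 𝕜) : ‖mulLp μ g‖ ≤ ‖g‖ :=
  LinearMap.mkContinuous_norm_le _ (norm_nonneg _) _

theorem inner_mulLp (g : α →ᵇ 𝕜) (f f' : Lp 𝕜 2 μ) :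
    inner 𝕜 (mulLp μ g f) f' = ∫ x, f' x * (starRingEnd 𝕜) (g x * f x) ∂μ := by
  rw [L2.inner_def]
  refine integral_congr_ae ?_
  filter_upwards [mulLp_ae g f] with x hx
  rw [hx, RCLike.inner_apply]

theorem isSymmetric_mulLp {g : α →ᵇ 𝕜} (hg : ∀ x, (starRingEnd 𝕜) (g x) = g x) (f f' : Lp 𝕜 2 μ) :
    inner 𝕜 (mulLp μ g f) f' = inner 𝕜 f (mulLp μ g f') := by
  rw [inner_mulLp, L2.inner_def]
  refine integral_congr_ae ?_
  filter_upwards [mulLp_ae g f'] with x hx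
  rw [hx, RCLike.inner_apply, map_mul, hg]
  ring

theorem re_inner_mulLp_self_nonneg {g : α →ᵇ 𝕜} {G : α → ℝ} (hG : ∀ x, g x = (G x : 𝕜))
    (h0 : ∀ x, 0 ≤ G x) (f : Lp 𝕜 2 μ) : 0 ≤ RCLike.re (inner 𝕜 (mulLp μ g f) f) := by
  rw [inner_mulLp]
  have h : ∀ x, f x * (starRingEnd 𝕜) (g x * f x) = ((G x * ‖f x‖ ^ 2 : ℝ) : 𝕜) := by
    intro x
    rw [hG, map_mul, RCLike.conj_ofReal, mul_left_comm, RCLike.mul_conj]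
    push_cast
    rfl
  simp_rw [h]
  rw [integral_ofReal, RCLike.ofReal_re]
  exact integral_nonneg fun x => mul_nonneg (h0 x) (sq_nonneg _)

theorem isPositive_mulLp {g : α →ᵇ 𝕜} {G : α → ℝ} (hG : ∀ x, g x = (G x : 𝕜))
    (h0 : ∀ x, 0 ≤ G x) : (mulLp μ g).IsPositive := by
  refine ⟨isSymmetric_mulLp fun x => by rw [hG, RCLike.conj_ofReal], fun f => ?_⟩
  exact re_inner_mulLp_self_nonneg hG h0 f

theorem mulLp_injective {g : α →ᵇ 𝕜} (hg : ∀ x, g x ≠ 0) : Function.Injective (mulLp μ g) := by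
  refine (injective_iff_map_eq_zero _).2 fun f hf => ?_
  rw [Lp.eq_zero_iff_ae_eq_zero] at hf ⊢
  filter_upwards [hf, mulLp_ae g f] with x h1 h2
  rw [h1] at h2
  exact (mul_eq_zero.1 h2.symm).resolve_left (hg x)

end MulLp

/-! ### Perturbation of the resolvent -/

/-- Bounded perturbation of a resolvent: if `R₀` and `W` are positive and `‖W R₀‖ < 1`, then
`(R₀⁻¹ + W)⁻¹ = R₀ (1 + W R₀)⁻¹` is positive and injective. -/
theorem exists_perturbed_resolvent {H : Type*} [NormedAddCommGroup H] [InnerProductSpace ℂ H]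
    [CompleteSpace H] {R₀ W : H →L[ℂ] H} (hR : R₀.IsPositive) (hinj : Function.Injective R₀)
    (hW : W.IsPositive) (hlt : ‖W * R₀‖ < 1) :
    ∃ K : H →L[ℂ] H, (R₀ * K).IsPositive ∧ Function.Injective (R₀ * K) ∧
      ∀ y, K y + W (R₀ (K y)) = y := by
  let U := Units.oneSub (-(W * R₀)) (by rwa [norm_neg])
  have hU : (U : H →L[ℂ] H) = 1 + W * R₀ := by
    simp [U, Units.val_oneSub]
  let K : H →L[ℂ] H := ((U⁻¹ : (H →L[ℂ] H)ˣ) : H →L[ℂ] H)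
  have h1 : ∀ y, K y + W (R₀ (K y)) = y := by
    intro y
    have : (U : H →L[ℂ] H) * K = 1 := U.mul_inv
    rw [hU] at this
    exact DFunLike.congr_fun this y
  have h2 : Function.Injective K := by
    intro a b hab
    rw [← h1 a, ← h1 b, hab]
  refine ⟨K, ⟨fun x y => ?_, fun x => ?_⟩, hinj.comp h2, h1⟩
  · change inner ℂ (R₀ (K x)) y = inner ℂ x (R₀ (K y))
    -- Symmetry is checked with both arguments written in the form `K y + W R₀ K y`, where it
    -- reduces to that of `R₀` and `W`.
    have e1 : inner ℂ (R₀ (K x)) (K y + W (R₀ (K y))) =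
        inner ℂ (K x + W (R₀ (K x))) (R₀ (K y)) := by
      rw [inner_add_left, inner_add_right]
      have a := hR.isSymmetric (K x) (K y)
      have b := hW.isSymmetric (R₀ (K x)) (R₀ (K y))
      simp only [ContinuousLinearMap.coe_coe] at a b
      rw [a, b]
    rwa [h1, h1] at e1
  · change 0 ≤ RCLike.re (inner ℂ (R₀ (K x)) x)
    have e1 : inner ℂ (R₀ (K x)) x = inner ℂ (R₀ (K x)) (K x) +
        inner ℂ (R₀ (K x)) (W (R₀ (K x))) := by
      rw [← inner_add_right, h1]
    rw [e1, map_add]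
    exact add_nonneg (hR.re_inner_nonneg_left _) (hW.re_inner_nonneg_right _)

/-! ### Derivatives on the Fourier side -/

section FourierDerivative

open scoped FourierTransform LineDeriv SchwartzMap
open TemperedDistribution

variable {E : Type*} [NormedAddCommGroup E] [InnerProductSpace ℝ E] [FiniteDimensional ℝ E]
  [MeasurableSpace E] [BorelSpace E]

/-- `g ∈ L²` is the derivative of `f ∈ L²` in direction `m`, in the sense of tempered
distributions. -/
def IsTemperedDeriv (m : E) (f g : Lp (α := E) ℂ 2) : Prop :=
  ∂_{m} (Lp.toTemperedDistribution f : 𝓢'(E, ℂ)) = Lp.toTemperedDistribution g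

/-- The symbol of the directional derivative. -/
noncomputable def derivSymbol (m ξ : E) : ℂ := (2 * Real.pi * Complex.I) * (inner ℝ ξ m : ℝ)

theorem smulLeftCLM_toTemperedDistribution_apply (m : E) (a : Lp (α := E) ℂ 2) (φ : 𝓢(E, ℂ)) :
    ((2 * Real.pi * Complex.I) • smulLeftCLM ℂ (fun ξ : E => ((inner ℝ ξ m : ℝ) : ℂ))
      (Lp.toTemperedDistribution a : 𝓢'(E, ℂ))) φ = ∫ ξ, φ ξ • (derivSymbol m ξ * a ξ) := by
  have ht : (fun ξ : E => ((inner ℝ ξ m : ℝ) : ℂ)).HasTemperateGrowth := by fun_prop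
  change (2 * Real.pi * Complex.I) • (smulLeftCLM ℂ (fun ξ : E => ((inner ℝ ξ m : ℝ) : ℂ))
      (Lp.toTemperedDistribution a : 𝓢'(E, ℂ)) φ) = _
  rw [smulLeftCLM_apply_apply, Lp.toTemperedDistribution_apply, ← integral_smul]
  refine integral_congr_ae (Eventually.of_forall fun ξ => ?_)
  simp only [SchwartzMap.smulLeftCLM_apply_apply ht, derivSymbol, smul_eq_mul]
  ring

theorem isTemperedDeriv_fourierInv {m : E} {a b : Lp (α := E) ℂ 2}
    (h : ∀ᵐ ξ, b ξ = derivSymbol m ξ * a ξ) : IsTemperedDeriv m (𝓕⁻ a) (𝓕⁻ b) := by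
  rw [IsTemperedDeriv, ← Lp.fourierInv_toTemperedDistribution_eq,
    ← Lp.fourierInv_toTemperedDistribution_eq, lineDerivOp_fourierInv_eq]
  congr 1
  ext φ
  rw [smulLeftCLM_toTemperedDistribution_apply, Lp.toTemperedDistribution_apply]
  refine integral_congr_ae ?_
  filter_upwards [h] with ξ hξ
  rw [hξ]

theorem IsTemperedDeriv.fourier_ae {m : E} {f g : Lp (α := E) ℂ 2} (h : IsTemperedDeriv m f g) :
    ∀ᵐ ξ, (𝓕 g : Lp (α := E) ℂ 2) ξ = derivSymbol m ξ * (𝓕 f : Lp (α := E) ℂ 2) ξ := by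
  have h1 := congrArg (fun T : 𝓢'(E, ℂ) => 𝓕 T) h
  beta_reduce at h1
  rw [fourier_lineDerivOp_eq, Lp.fourier_toTemperedDistribution_eq,
    Lp.fourier_toTemperedDistribution_eq] at h1
  have hloc : ∀ f : Lp (α := E) ℂ 2, LocallyIntegrable f := fun f =>
    (Lp.memLp f).locallyIntegrable (by norm_num)
  have hcont : Continuous (derivSymbol m) := by unfold derivSymbol; fun_prop
  refine ae_eq_of_integral_contDiff_smul_eq (hloc _) ((hloc (𝓕 f)).continuous_mul hcont)
    fun η hη hηc => ?_
  have hg₁ : HasCompactSupport (Complex.ofRealCLM ∘ η) := hηc.comp_left rfl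
  have hg₂ : ContDiff ℝ ∞ (Complex.ofRealCLM ∘ η) := by fun_prop
  have h2 := congrArg (fun T : 𝓢'(E, ℂ) => T (hg₁.toSchwartzMap hg₂)) h1
  beta_reduce at h2
  rw [smulLeftCLM_toTemperedDistribution_apply, Lp.toTemperedDistribution_apply] at h2
  simpa using h2.symm

/-- By Plancherel, since the symbol `2πi⟨ξ, m⟩` is purely imaginary. -/
theorem IsTemperedDeriv.inner_eq_neg {m : E} {f g f' g' : Lp (α := E) ℂ 2}
    (h : IsTemperedDeriv m f g) (h' : IsTemperedDeriv m f' g') :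
    inner ℂ g f' = -inner ℂ f g' := by
  rw [← Lp.inner_fourier_eq g f', ← Lp.inner_fourier_eq f g', L2.inner_def, L2.inner_def,
    ← integral_neg]
  refine integral_congr_ae ?_
  filter_upwards [h.fourier_ae, h'.fourier_ae] with ξ h1 h2
  rw [h1, h2, RCLike.inner_apply, RCLike.inner_apply, map_mul]
  have : (starRingEnd ℂ) (derivSymbol m ξ) = -derivSymbol m ξ := by
    simp [derivSymbol, map_ofNat]
  rw [this]
  ring

end FourierDerivative

/-! ### Weak derivatives as tempered derivatives, and symmetry of the Laplacian -/

section WeakPartial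

open scoped LineDeriv SchwartzMap

variable {n : ℕ}

/-- The complex Hilbert space `L²(ℝⁿ; ℂ)`. -/
abbrev ComplexL2 (n : ℕ) : Type := Lp (α := EuclideanSpace ℝ (Fin n)) ℂ 2

/-- The inclusion of real-valued into complex-valued `L²` functions. -/
noncomputable def ofRealL2 (n : ℕ) : L2 n →L[ℝ] ComplexL2 n := Complex.ofRealCLM.compLpL 2 volume

/-- The real part of a complex-valued `L²` function. -/
noncomputable def reL2 (n : ℕ) : ComplexL2 n →L[ℝ] L2 n := Complex.reCLM.compLpL 2 volume

theorem ofRealL2_ae (f : L2 n) : ∀ᵐ x, ofRealL2 n f x = (f x : ℂ) :=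
  Complex.ofRealCLM.coeFn_compLpL f

theorem reL2_ae (f : ComplexL2 n) : ∀ᵐ x, reL2 n f x = (f x).re :=
  Complex.reCLM.coeFn_compLpL f

theorem reL2_ofRealL2 (f : L2 n) : reL2 n (ofRealL2 n f) = f := by
  refine Lp.ext ?_
  filter_upwards [reL2_ae (ofRealL2 n f), ofRealL2_ae f] with x h1 h2
  rw [h1, h2, Complex.ofReal_re]

theorem inner_ofRealL2 (f g : L2 n) :
    inner ℂ (ofRealL2 n f) (ofRealL2 n g) = ((inner ℝ f g : ℝ) : ℂ) := by
  rw [L2.inner_def, L2.inner_def, ← integral_complex_ofReal]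
  refine integral_congr_ae ?_
  filter_upwards [ofRealL2_ae f, ofRealL2_ae g] with x h1 h2
  rw [h1, h2]
  simp

/-- The weak derivative may be tested against smooth functions that are merely square integrable
together with the derivative in question. -/
theorem IsWeakPartial.integral_eq {i : Fin n} {f g : L2 n} (h : IsWeakPartial i f g)
    {ψ : EuclideanSpace ℝ (Fin n) → ℝ} (hψ : ContDiff ℝ ∞ ψ) (h2 : MemLp ψ 2)
    (h2' : MemLp (partialDeriv i ψ) 2) :
    ∫ x, f x * partialDeriv i ψ x = -∫ x, g x * ψ x := by
  let χ : ContDiffBump (0 : EuclideanSpace ℝ (Fin n)) := ⟨1, 2, one_pos, one_lt_two⟩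
  have hχd : ContDiff ℝ ∞ χ := χ.contDiff
  have hχs : HasCompactSupport χ := χ.hasCompactSupport
  let c : ℕ → ℝ := fun k => 1 / ((k : ℝ) + 1)
  have hc0 : ∀ k, 0 < c k := fun k => Nat.one_div_pos_of_nat
  have hc1 : ∀ k, c k ≤ 1 := fun k => by
    rw [div_le_one (by positivity)]
    linarith [Nat.cast_nonneg (α := ℝ) k]
  have hclim : Tendsto c atTop (𝓝 0) := tendsto_one_div_add_atTop_nhds_zero_nat
  let X : ℕ → EuclideanSpace ℝ (Fin n) → ℝ := fun k x => χ (c k • x)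
  have hXd : ∀ k, ContDiff ℝ ∞ (X k) := fun k => hχd.comp (contDiff_const_smul (c k))
  have hXs : ∀ k, HasCompactSupport (X k) := fun k =>
    hχs.comp_homeomorph (Homeomorph.smulOfNeZero (c k) (hc0 k).ne')
  have hXp : ∀ k x, partialDeriv i (X k) x = c k * partialDeriv i χ (c k • x) := by
    intro k x
    rw [partialDeriv, partialDeriv]
    change fderiv ℝ (fun x => χ (c k • x)) x _ = _
    rw [fderiv_comp_smul]
    rfl
  obtain ⟨M, hM⟩ := (hasCompactSupport_partialDeriv i hχs).exists_bound_of_continuous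
    (continuous_partialDeriv i hχd)
  have hX1 : ∀ k x, ‖X k x‖ ≤ 1 := fun k x => by
    rw [Real.norm_of_nonneg χ.nonneg]
    exact χ.le_one
  have hXlim : ∀ x, Tendsto (fun k => X k x) atTop (𝓝 1) := by
    intro x
    have h1 : Tendsto (fun k => c k • x) atTop (𝓝 0) := by
      simpa using hclim.smul_const x
    have h3 := (hχd.continuous.tendsto 0).comp h1
    rwa [χ.one_of_mem_closedBall (by simp [χ])] at h3
  have hXplim : ∀ x, Tendsto (fun k => partialDeriv i (X k) x) atTop (𝓝 0) := by
    intro x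
    refine squeeze_zero_norm (a := fun k => c k * M) (fun k => ?_) ?_
    · rw [hXp, norm_mul, Real.norm_of_nonneg (hc0 k).le]
      exact mul_le_mul_of_nonneg_left (hM _) (hc0 k).le
    · simpa using hclim.mul_const M
  have hprod : ∀ k x, partialDeriv i (fun x => X k x * ψ x) x =
      X k x * partialDeriv i ψ x + ψ x * partialDeriv i (X k) x := by
    intro k x
    rw [partialDeriv, fderiv_fun_mul ((hXd k).differentiable (by simp) x)
      (hψ.differentiable (by simp) x)]
    rfl
  have hcψ : Continuous (partialDeriv i ψ) := continuous_partialDeriv i hψ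
  have hcX : ∀ k, Continuous (partialDeriv i (X k)) := fun k => continuous_partialDeriv i (hXd k)
  have hint : ∀ (f : L2 n) {φ : EuclideanSpace ℝ (Fin n) → ℝ}, MemLp φ 2 →
      Integrable (fun x => f x * φ x) := fun f φ hφ => (Lp.memLp f).integrable_mul (q := 2) hφ
  -- This dominates `∂ᵢ(X k · ψ)` for all `k`: the cutoffs are at most `1` and, as `c k ≤ 1`, their
  -- derivatives are at most `M`.
  have hMψ : MemLp (fun x => ‖partialDeriv i ψ x‖ + M * ‖ψ x‖) 2 :=
    h2'.norm.add (h2.norm.const_mul M)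
  have L1 : Tendsto (fun k => ∫ x, f x * partialDeriv i (fun x => X k x * ψ x) x) atTop
      (𝓝 (∫ x, f x * partialDeriv i ψ x)) := by
    refine tendsto_integral_of_dominated_convergence
      (fun x => ‖f x * (‖partialDeriv i ψ x‖ + M * ‖ψ x‖)‖)
      (fun k => ?_) (hint f hMψ).norm (fun k => Eventually.of_forall fun x => ?_)
      (Eventually.of_forall fun x => ?_)
    · refine (Lp.aestronglyMeasurable f).mul (Continuous.aestronglyMeasurable ?_)
      exact continuous_partialDeriv i ((hXd k).mul hψ)
    · rw [norm_mul, norm_mul, hprod]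
      refine mul_le_mul_of_nonneg_left ?_ (norm_nonneg _)
      refine le_trans ?_ (le_abs_self _)
      refine (norm_add_le _ _).trans (add_le_add ?_ ?_)
      · rw [norm_mul]
        exact mul_le_of_le_one_left (norm_nonneg _) (hX1 k x)
      · rw [norm_mul, mul_comm, hXp, norm_mul, Real.norm_of_nonneg (hc0 k).le]
        refine mul_le_mul_of_nonneg_right ?_ (norm_nonneg _)
        exact (mul_le_of_le_one_left (norm_nonneg _) (hc1 k)).trans (hM _)
    · simp_rw [hprod]
      have := (((hXlim x).mul_const (partialDeriv i ψ x)).add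
        ((hXplim x).const_mul (ψ x))).const_mul (f x)
      simpa using this
  have L2' : Tendsto (fun k => ∫ x, g x * (X k x * ψ x)) atTop (𝓝 (∫ x, g x * ψ x)) := by
    refine tendsto_integral_of_dominated_convergence (fun x => ‖g x * ψ x‖)
      (fun k => ?_) (hint g h2).norm (fun k => Eventually.of_forall fun x => ?_)
      (Eventually.of_forall fun x => ?_)
    · exact (Lp.aestronglyMeasurable g).mul
        ((hXd k).continuous.mul hψ.continuous).aestronglyMeasurable
    · rw [norm_mul, norm_mul, norm_mul]
      exact mul_le_mul_of_nonneg_left (mul_le_of_le_one_left (norm_nonneg _) (hX1 k x))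
        (norm_nonneg _)
    · simpa using ((hXlim x).mul_const (ψ x)).const_mul (g x)
  refine tendsto_nhds_unique L1 ?_
  refine (L2'.neg).congr fun k => ?_
  exact (h _ ((hXd k).mul hψ) ((hXs k).mul_right)).symm

theorem clm_integral_schwartz_smul_ofRealL2 (L : ℂ →L[ℝ] ℝ) (f : L2 n)
    (φ : 𝓢(EuclideanSpace ℝ (Fin n), ℂ)) :
    L (∫ x, φ x • ofRealL2 n f x) = ∫ x, f x * L (φ x) := by
  have hi : Integrable (fun x => φ x • ofRealL2 n f x) :=
    (φ.memLp 2).integrable_mul (q := 2) (Lp.memLp (ofRealL2 n f))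
  rw [← L.integral_comp_comm hi]
  refine integral_congr_ae ?_
  filter_upwards [ofRealL2_ae f] with x hx
  rw [hx, smul_eq_mul, mul_comm, ← Complex.real_smul, map_smul, smul_eq_mul]

theorem IsWeakPartial.isTemperedDeriv {i : Fin n} {f g : L2 n} (h : IsWeakPartial i f g) :
    IsTemperedDeriv (EuclideanSpace.single i 1) (ofRealL2 n f) (ofRealL2 n g) := by
  rw [IsTemperedDeriv]
  ext φ
  rw [TemperedDistribution.lineDerivOp_apply_apply, map_neg, Lp.toTemperedDistribution_apply,
    Lp.toTemperedDistribution_apply]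
  -- Weak derivatives are tested against real functions, so real and imaginary parts of the Schwartz
  -- function are treated separately.
  have key : ∀ L : ℂ →L[ℝ] ℝ,
      L (-∫ x, (∂_{EuclideanSpace.single i (1 : ℝ)} φ) x • ofRealL2 n f x) =
        L (∫ x, φ x • ofRealL2 n g x) := by
    intro L
    rw [map_neg, clm_integral_schwartz_smul_ofRealL2, clm_integral_schwartz_smul_ofRealL2]
    have hp : ∀ x, L ((∂_{EuclideanSpace.single i (1 : ℝ)} φ) x) =
        partialDeriv i (fun x => L (φ x)) x := by
      intro x
      have : HasFDerivAt (fun x => L (φ x)) (L.comp (fderiv ℝ φ x)) x :=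
        L.hasFDerivAt.comp x (φ.hasFDerivAt x)
      rw [partialDeriv, this.fderiv, SchwartzMap.lineDerivOp_apply_eq_fderiv]
      rfl
    simp_rw [hp]
    rw [h.integral_eq (ψ := fun x => L (φ x)) (L.contDiff.comp (φ.smooth ⊤)) (L.comp_memLp' (φ.memLp 2)), neg_neg]
    refine MemLp.ae_eq (Eventually.of_forall hp)
      (L.comp_memLp' ((∂_{EuclideanSpace.single i (1 : ℝ)} φ).memLp 2))
  exact Complex.ext (key Complex.reCLM) (key Complex.imCLM)

theorem IsTemperedDeriv.isWeakPartial {i : Fin n} {f g : ComplexL2 n}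
    (h : IsTemperedDeriv (EuclideanSpace.single i 1) f g) :
    IsWeakPartial i (reL2 n f) (reL2 n g) := by
  intro φ hφ hs
  have hg₁ : HasCompactSupport (Complex.ofRealCLM ∘ φ) := hs.comp_left rfl
  have hg₂ : ContDiff ℝ ∞ (Complex.ofRealCLM ∘ φ) := by fun_prop
  let Φ := hg₁.toSchwartzMap hg₂
  have hΦ : ∀ x, Φ x = (φ x : ℂ) := fun x => rfl
  have hdΦ : ∀ x, (∂_{EuclideanSpace.single i (1 : ℝ)} Φ) x = (partialDeriv i φ x : ℂ) := by
    intro x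
    have : HasFDerivAt (fun x => Complex.ofRealCLM (φ x))
        (Complex.ofRealCLM.comp (fderiv ℝ φ x)) x :=
      Complex.ofRealCLM.hasFDerivAt.comp x (hφ.differentiable (by simp) x).hasFDerivAt
    rw [SchwartzMap.lineDerivOp_apply_eq_fderiv]
    change fderiv ℝ (fun x => Complex.ofRealCLM (φ x)) x _ = _
    rw [this.fderiv]
    rfl
  have h1 := congrArg (fun T : 𝓢'(EuclideanSpace ℝ (Fin n), ℂ) => (T Φ).re) h
  beta_reduce at h1
  rw [TemperedDistribution.lineDerivOp_apply_apply, map_neg, Lp.toTemperedDistribution_apply,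
    Lp.toTemperedDistribution_apply, Complex.neg_re] at h1
  have key : ∀ (f : ComplexL2 n) (Ψ : 𝓢(EuclideanSpace ℝ (Fin n), ℂ))
      (ψ : EuclideanSpace ℝ (Fin n) → ℝ), (∀ x, Ψ x = (ψ x : ℂ)) →
      (∫ x, Ψ x • f x).re = ∫ x, reL2 n f x * ψ x := by
    intro f Ψ ψ hψ
    have hi : Integrable (fun x => Ψ x • f x) :=
      (Ψ.memLp 2).integrable_mul (q := 2) (Lp.memLp f)
    change Complex.reCLM (∫ x, Ψ x • f x) = _
    rw [← Complex.reCLM.integral_comp_comm hi]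
    refine integral_congr_ae ?_
    filter_upwards [reL2_ae f] with x hx
    rw [hx, hψ, smul_eq_mul, Complex.reCLM_apply, Complex.re_ofReal_mul, mul_comm]
  rw [key f _ _ hdΦ, key g _ _ hΦ] at h1
  linarith

theorem IsWeakPartial.inner_eq_neg {i : Fin n} {f g f' g' : L2 n} (h : IsWeakPartial i f g)
    (h' : IsWeakPartial i f' g') : inner ℝ g f' = -inner ℝ f g' := by
  have := h.isTemperedDeriv.inner_eq_neg h'.isTemperedDeriv
  rw [inner_ofRealL2, inner_ofRealL2] at this
  exact_mod_cast this

namespace SobolevH2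

theorem inner_laplacian_left (w z : SobolevH2 n) :
    inner ℝ (laplacian w) (toL2 z) = -∑ i, inner ℝ (w.1.2.1 i) (z.1.2.1 i) := by
  rw [laplacian, sum_inner, ← Finset.sum_neg_distrib]
  exact Finset.sum_congr rfl fun i _ => (w.2.2 i i).inner_eq_neg (z.2.1 i)

theorem inner_laplacian_comm (w z : SobolevH2 n) :
    inner ℝ (laplacian w) (toL2 z) = inner ℝ (toL2 w) (laplacian z) := by
  rw [inner_laplacian_left, real_inner_comm, inner_laplacian_left]
  simp_rw [real_inner_comm]

theorem inner_laplacian_self_nonpos (w : SobolevH2 n) :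
    inner ℝ (laplacian w) (toL2 w) ≤ 0 := by
  rw [inner_laplacian_left, neg_nonpos]
  exact Finset.sum_nonneg fun i _ => real_inner_self_nonneg

end SobolevH2

end WeakPartial

/-! ### Linearity of multiplication in the symbol -/

section MulLpAlgebra

variable {α : Type*} [TopologicalSpace α] [MeasurableSpace α] [BorelSpace α]
  {μ : Measure α} {𝕜 : Type*} [RCLike 𝕜]

theorem mulLp_add (g g' : α →ᵇ 𝕜) : mulLp μ (g + g') = mulLp μ g + mulLp μ g' := by
  ext1 f
  refine Lp.ext ?_
  rw [_root_.add_apply]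
  filter_upwards [mulLp_ae (g + g') f, mulLp_ae g f, mulLp_ae g' f,
    Lp.coeFn_add (mulLp μ g f) (mulLp μ g' f)] with x h1 h2 h3 h4
  rw [h1, h4, Pi.add_apply, h2, h3, BoundedContinuousFunction.add_apply, add_mul]

theorem mulLp_sum {ι : Type*} (s : Finset ι) (g : ι → α →ᵇ 𝕜) :
    mulLp μ (∑ i ∈ s, g i) = ∑ i ∈ s, mulLp μ (g i) := by
  classical
  induction s using Finset.induction_on with
  | empty =>
    rw [Finset.sum_empty, Finset.sum_empty]
    have := mulLp_add (μ := μ) (0 : α →ᵇ 𝕜) 0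
    rw [add_zero] at this
    exact left_eq_add.1 this
  | insert i s hi ih => rw [Finset.sum_insert hi, Finset.sum_insert hi, mulLp_add, ih]

theorem mulLp_smul_sub_one (c : 𝕜) (g : α →ᵇ 𝕜) (f : Lp 𝕜 2 μ) :
    mulLp μ (c • g - 1) f = c • mulLp μ g f - f := by
  refine Lp.ext ?_
  filter_upwards [mulLp_ae (c • g - 1) f, mulLp_ae g f, Lp.coeFn_sub (c • mulLp μ g f) f,
    Lp.coeFn_smul c (mulLp μ g f)] with x h1 h2 h3 h4
  rw [h1, h3, Pi.sub_apply, h4, Pi.smul_apply, h2, BoundedContinuousFunction.sub_apply,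
    BoundedContinuousFunction.smul_apply, BoundedContinuousFunction.coe_one, Pi.one_apply, sub_mul, one_mul,
    smul_eq_mul, smul_eq_mul, mul_assoc]

end MulLpAlgebra

/-! ### Symbols of the resolvent and its derivatives -/

section ResolventSymbol

variable {E : Type*} [NormedAddCommGroup E]

/-- The symbol `(c + |2πξ|²)⁻¹` of the resolvent of the Laplacian. -/
noncomputable def resolventFun (c : ℝ) (ξ : E) : ℝ := (c + (2 * Real.pi * ‖ξ‖) ^ 2)⁻¹

theorem resolventFun_pos {c : ℝ} (hc : 0 < c) (ξ : E) : 0 < resolventFun c ξ := by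
  unfold resolventFun
  positivity

theorem continuous_resolventFun {c : ℝ} (hc : 0 < c) : Continuous (resolventFun c : E → ℝ) := by
  unfold resolventFun
  exact Continuous.inv₀ (by fun_prop) fun ξ => by positivity

theorem resolventFun_le {c : ℝ} (hc : 0 < c) (ξ : E) : resolventFun c ξ ≤ c⁻¹ := by
  unfold resolventFun
  gcongr
  nlinarith [sq_nonneg (2 * Real.pi * ‖ξ‖)]

theorem mul_resolventFun_le {c : ℝ} (hc : 0 < c) (ξ : E) :
    2 * Real.pi * ‖ξ‖ * resolventFun c ξ ≤ c⁻¹ + 1 := by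
  unfold resolventFun
  set s := 2 * Real.pi * ‖ξ‖
  rw [← div_eq_mul_inv, div_le_iff₀ (by positivity)]
  have h1 : c⁻¹ * c = 1 := inv_mul_cancel₀ hc.ne'
  have h2 : 0 < c⁻¹ := inv_pos.2 hc
  nlinarith [sq_nonneg (s - 1), mul_nonneg h2.le (sq_nonneg s)]

theorem sq_mul_resolventFun_le {c : ℝ} (hc : 0 < c) (ξ : E) :
    (2 * Real.pi * ‖ξ‖) ^ 2 * resolventFun c ξ ≤ 1 := by
  unfold resolventFun
  rw [← div_eq_mul_inv, div_le_iff₀ (by positivity)]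
  linarith

open BoundedContinuousFunction in
/-- The symbol of `(c - Δ)⁻¹`. -/
noncomputable def resolventSymbol {c : ℝ} (hc : 0 < c) : E →ᵇ ℂ :=
  ofNormedAddCommGroup (fun ξ => (resolventFun c ξ : ℂ))
    (Complex.continuous_ofReal.comp (continuous_resolventFun hc)) c⁻¹ fun ξ => by
      rw [Complex.norm_real, Real.norm_of_nonneg (resolventFun_pos hc ξ).le]
      exact resolventFun_le hc ξ

theorem norm_resolventSymbol_le {c : ℝ} (hc : 0 < c) : ‖(resolventSymbol hc : E →ᵇ ℂ)‖ ≤ c⁻¹ :=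
  BoundedContinuousFunction.norm_ofNormedAddCommGroup_le _ (inv_nonneg.2 hc.le) _

variable [InnerProductSpace ℝ E]

theorem continuous_derivSymbol (m : E) : Continuous (derivSymbol m) := by
  unfold derivSymbol
  fun_prop

theorem norm_derivSymbol_le (m ξ : E) : ‖derivSymbol m ξ‖ ≤ 2 * Real.pi * ‖ξ‖ * ‖m‖ := by
  have h : ‖derivSymbol m ξ‖ = 2 * Real.pi * |inner ℝ ξ m| := by
    simp [derivSymbol, abs_of_pos Real.pi_pos]
  rw [h, mul_assoc (2 * Real.pi)]
  exact mul_le_mul_of_nonneg_left (abs_real_inner_le_norm ξ m) (by positivity)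

open BoundedContinuousFunction in
/-- The symbol of `∂ₘ (c - Δ)⁻¹`. -/
noncomputable def derivResolventSymbol {c : ℝ} (hc : 0 < c) (m : E) : E →ᵇ ℂ :=
  ofNormedAddCommGroup (fun ξ => derivSymbol m ξ * (resolventFun c ξ : ℂ))
    ((continuous_derivSymbol m).mul
      (Complex.continuous_ofReal.comp (continuous_resolventFun hc))) ((c⁻¹ + 1) * ‖m‖) fun ξ => by
      rw [norm_mul, Complex.norm_real, Real.norm_of_nonneg (resolventFun_pos hc ξ).le]
      calc _ ≤ 2 * Real.pi * ‖ξ‖ * ‖m‖ * resolventFun c ξ :=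
            mul_le_mul_of_nonneg_right (norm_derivSymbol_le m ξ) (resolventFun_pos hc ξ).le
        _ = 2 * Real.pi * ‖ξ‖ * resolventFun c ξ * ‖m‖ := by ring
        _ ≤ _ := mul_le_mul_of_nonneg_right (mul_resolventFun_le hc ξ) (norm_nonneg _)

open BoundedContinuousFunction in
/-- The symbol of `∂ₘ' ∂ₘ (c - Δ)⁻¹`. -/
noncomputable def derivDerivResolventSymbol {c : ℝ} (hc : 0 < c) (m m' : E) : E →ᵇ ℂ :=
  ofNormedAddCommGroup (fun ξ => derivSymbol m' ξ * (derivSymbol m ξ * (resolventFun c ξ : ℂ)))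
    ((continuous_derivSymbol m').mul ((continuous_derivSymbol m).mul
      (Complex.continuous_ofReal.comp (continuous_resolventFun hc)))) (‖m'‖ * ‖m‖) fun ξ => by
      rw [norm_mul, norm_mul, Complex.norm_real, Real.norm_of_nonneg (resolventFun_pos hc ξ).le]
      have h := (resolventFun_pos hc ξ).le
      calc _ ≤ 2 * Real.pi * ‖ξ‖ * ‖m'‖ * (2 * Real.pi * ‖ξ‖ * ‖m‖ * resolventFun c ξ) := by
            have h1 := norm_derivSymbol_le m ξ
            have h2 := norm_derivSymbol_le m' ξ
            gcongr
        _ = (2 * Real.pi * ‖ξ‖) ^ 2 * resolventFun c ξ * (‖m'‖ * ‖m‖) := by ring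
        _ ≤ _ := mul_le_of_le_one_left (by positivity) (sq_mul_resolventFun_le hc ξ)

/-- The Fourier form of `Δ(c - Δ)⁻¹ = c(c - Δ)⁻¹ - 1`, by Parseval for `ξ` in the basis `b`. -/
theorem sum_derivDerivResolventSymbol {c : ℝ} (hc : 0 < c) {ι : Type*} [Fintype ι]
    (b : OrthonormalBasis ι ℝ E) :
    ∑ i, derivDerivResolventSymbol hc (b i) (b i) = (c : ℂ) • resolventSymbol hc - 1 := by
  ext ξ
  rw [BoundedContinuousFunction.coe_sum, Finset.sum_apply]
  change ∑ i, derivSymbol (b i) ξ * (derivSymbol (b i) ξ * (resolventFun c ξ : ℂ)) =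
    (c : ℂ) * (resolventFun c ξ : ℂ) - 1
  have h1 : ∀ i, derivSymbol (b i) ξ * (derivSymbol (b i) ξ * (resolventFun c ξ : ℂ)) =
      ((-(2 * Real.pi) ^ 2 * resolventFun c ξ * inner ℝ ξ (b i) ^ 2 : ℝ) : ℂ) := by
    intro i
    have := Complex.I_mul_I
    rw [derivSymbol]
    push_cast
    linear_combination 4 * (Real.pi : ℂ) ^ 2 * (resolventFun c ξ : ℂ) *
      ((inner ℝ ξ (b i) : ℝ) : ℂ) ^ 2 * this
  simp_rw [h1]
  rw [← Complex.ofReal_sum, ← Finset.mul_sum, b.sum_sq_inner_left]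
  have h2 : resolventFun c ξ * (c + (2 * Real.pi * ‖ξ‖) ^ 2) = 1 :=
    inv_mul_cancel₀ (by positivity)
  norm_cast
  linarith

end ResolventSymbol

/-! ### Fourier multipliers on `L²` -/

section FourierMultiplier

open scoped FourierTransform

variable {E : Type*} [NormedAddCommGroup E] [InnerProductSpace ℝ E] [FiniteDimensional ℝ E]
  [MeasurableSpace E] [BorelSpace E]

/-- The Fourier multiplier on `L²` with a bounded continuous symbol. -/
noncomputable def fourierMul (g : E →ᵇ ℂ) : Lp (α := E) ℂ 2 →L[ℂ] Lp (α := E) ℂ 2 :=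
  ((Lp.fourierTransformₗᵢ E ℂ).symm.toContinuousLinearEquiv :
      Lp (α := E) ℂ 2 →L[ℂ] Lp (α := E) ℂ 2) ∘L mulLp volume g ∘L
    ((Lp.fourierTransformₗᵢ E ℂ).toContinuousLinearEquiv :
      Lp (α := E) ℂ 2 →L[ℂ] Lp (α := E) ℂ 2)

theorem fourierMul_apply (g : E →ᵇ ℂ) (f : Lp (α := E) ℂ 2) :
    fourierMul g f = 𝓕⁻ (mulLp volume g (𝓕 f)) := rfl

theorem fourier_fourierMul (g : E →ᵇ ℂ) (f : Lp (α := E) ℂ 2) :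
    𝓕 (fourierMul g f) = mulLp volume g (𝓕 f) := by
  rw [fourierMul_apply, FourierTransform.fourier_fourierInv_eq]

theorem norm_fourierMul_le (g : E →ᵇ ℂ) : ‖fourierMul g‖ ≤ ‖g‖ := by
  refine ContinuousLinearMap.opNorm_le_bound _ (norm_nonneg _) fun f => ?_
  rw [← Lp.norm_fourier_eq, fourier_fourierMul, ← Lp.norm_fourier_eq f]
  exact (mulLp volume g).le_of_opNorm_le (norm_mulLp_le g) _

theorem fourierMul_injective {g : E →ᵇ ℂ} (hg : ∀ x, g x ≠ 0) :
    Function.Injective (fourierMul g) :=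
  (Lp.fourierTransformₗᵢ E ℂ).symm.injective.comp
    ((mulLp_injective hg).comp (Lp.fourierTransformₗᵢ E ℂ).injective)

theorem isPositive_fourierMul {g : E →ᵇ ℂ} {G : E → ℝ} (hG : ∀ x, g x = (G x : ℂ))
    (h0 : ∀ x, 0 ≤ G x) : (fourierMul g).IsPositive := by
  have h := isPositive_mulLp (μ := volume) hG h0
  refine ⟨fun f f' => ?_, fun f => ?_⟩
  · change inner ℂ (fourierMul g f) f' = inner ℂ f (fourierMul g f')
    rw [← Lp.inner_fourier_eq, fourier_fourierMul, ← Lp.inner_fourier_eq f, fourier_fourierMul]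
    exact h.isSymmetric _ _
  · change 0 ≤ RCLike.re (inner ℂ (fourierMul g f) f)
    rw [← Lp.inner_fourier_eq, fourier_fourierMul]
    exact h.re_inner_nonneg_left _

theorem isTemperedDeriv_fourierMul {m : E} {g g' : E →ᵇ ℂ}
    (h : ∀ ξ, g' ξ = derivSymbol m ξ * g ξ) (f : Lp (α := E) ℂ 2) :
    IsTemperedDeriv m (fourierMul g f) (fourierMul g' f) := by
  rw [fourierMul_apply, fourierMul_apply]
  refine isTemperedDeriv_fourierInv ?_
  filter_upwards [mulLp_ae g (𝓕 f), mulLp_ae g' (𝓕 f)] with ξ h1 h2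
  rw [h1, h2, h, mul_assoc]

theorem sum_fourierMul_derivDerivResolventSymbol {c : ℝ} (hc : 0 < c) {ι : Type*} [Fintype ι]
    (b : OrthonormalBasis ι ℝ E) (f : Lp ℂ 2 (volume : Measure E)) :
    ∑ i, fourierMul (derivDerivResolventSymbol hc (b i) (b i)) f =
      (c : ℂ) • fourierMul (resolventSymbol hc) f - f := by
  apply (Lp.fourierTransformₗᵢ E ℂ).injective
  rw [map_sum, map_sub, map_smul]
  change ∑ i, 𝓕 (fourierMul (derivDerivResolventSymbol hc (b i) (b i)) f) =
    (c : ℂ) • 𝓕 (fourierMul (resolventSymbol hc) f) - 𝓕 f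
  simp_rw [fourier_fourierMul]
  rw [← mulLp_smul_sub_one (μ := volume), ← sum_derivDerivResolventSymbol hc b, mulLp_sum (μ := volume),
    _root_.sum_apply]

end FourierMultiplier

/-! ### Existence of the solution -/

section Existence

variable {n : ℕ}

open BoundedContinuousFunction in
/-- A real bounded continuous function, regarded as complex-valued. -/
noncomputable def complexify {α : Type*} [TopologicalSpace α] (V : α →ᵇ ℝ) : α →ᵇ ℂ :=
  ofNormedAddCommGroup (fun x => (V x : ℂ)) (Complex.continuous_ofReal.comp V.continuous) ‖V‖
    fun x => by rw [Complex.norm_real]; exact V.norm_coe_le_norm x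

theorem norm_complexify_le {α : Type*} [TopologicalSpace α] (V : α →ᵇ ℝ) : ‖complexify V‖ ≤ ‖V‖ :=
  BoundedContinuousFunction.norm_ofNormedAddCommGroup_le _ (norm_nonneg _) _

theorem reL2_mulLp_complexify (V : EuclideanSpace ℝ (Fin n) →ᵇ ℝ) (f : ComplexL2 n) :
    reL2 n (mulLp volume (complexify V) f) = mulLp volume V (reL2 n f) := by
  refine Lp.ext ?_
  filter_upwards [reL2_ae (mulLp volume (complexify V) f), mulLp_ae (complexify V) f,
    mulLp_ae V (reL2 n f), reL2_ae f] with x h1 h2 h3 h4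
  rw [h1, h2, h3, h4]
  exact Complex.re_ofReal_mul _ _

/-- The resolvent `(c - Δ)⁻¹` followed by the real part, as a map into `H²`. -/
noncomputable def resolventH2 (n : ℕ) {c : ℝ} (hc : 0 < c) (f : ComplexL2 n) : SobolevH2 n :=
  ⟨(reL2 n (fourierMul (resolventSymbol hc) f),
    fun i => reL2 n (fourierMul (derivResolventSymbol hc (EuclideanSpace.single i 1)) f),
    fun i j => reL2 n (fourierMul (derivDerivResolventSymbol hc (EuclideanSpace.single i 1)
      (EuclideanSpace.single j 1)) f)),
    fun _ => (isTemperedDeriv_fourierMul (fun _ => rfl) f).isWeakPartial,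
    fun _ _ => (isTemperedDeriv_fourierMul (fun _ => rfl) f).isWeakPartial⟩

theorem continuous_resolventH2 {c : ℝ} (hc : 0 < c) : Continuous (resolventH2 n hc) := by
  refine Continuous.subtype_mk (Continuous.prodMk ?_ (Continuous.prodMk
    (continuous_pi fun i => ?_) (continuous_pi fun i => continuous_pi fun j => ?_))) _
  all_goals exact (reL2 n).continuous.comp (fourierMul _).continuous

theorem toL2_resolventH2 {c : ℝ} (hc : 0 < c) (f : ComplexL2 n) :
    SobolevH2.toL2 (resolventH2 n hc f) = reL2 n (fourierMul (resolventSymbol hc) f) := rfl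

theorem laplacian_resolventH2 {c : ℝ} (hc : 0 < c) (f : ComplexL2 n) :
    SobolevH2.laplacian (resolventH2 n hc f) =
      reL2 n ((c : ℂ) • fourierMul (resolventSymbol hc) f - f) := by
  rw [← sum_fourierMul_derivDerivResolventSymbol hc (EuclideanSpace.basisFun (Fin n) ℝ), map_sum]
  simp_rw [EuclideanSpace.basisFun_apply]
  rfl

theorem exists_isHeatSolution (V : EuclideanSpace ℝ (Fin n) →ᵇ ℝ) (hV : ∀ x, 0 ≤ V x)
    (u₀ : L2 n) : ∃ u : ℝ → L2 n, IsHeatSolution V u₀ u := by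
  -- With this shift `‖V (c - Δ)⁻¹‖ ≤ ‖V‖ / c < 1`, so the Neumann series converges.
  set c : ℝ := ‖V‖ + 1
  have hc : 0 < c := by positivity
  set R₀ : ComplexL2 n →L[ℂ] ComplexL2 n := fourierMul (resolventSymbol hc)
  set W : ComplexL2 n →L[ℂ] ComplexL2 n := mulLp volume (complexify V)
  have hR₀ : R₀.IsPositive :=
    isPositive_fourierMul (fun _ => rfl) fun ξ => (resolventFun_pos hc ξ).le
  have hinj : Function.Injective R₀ :=
    fourierMul_injective fun ξ => Complex.ofReal_ne_zero.2 (resolventFun_pos hc ξ).ne'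
  have hW : W.IsPositive := isPositive_mulLp (fun _ => rfl) hV
  have hlt : ‖W * R₀‖ < 1 := by
    calc ‖W * R₀‖ ≤ ‖W‖ * ‖R₀‖ := norm_mul_le _ _
      _ ≤ ‖V‖ * c⁻¹ := mul_le_mul ((norm_mulLp_le _).trans (norm_complexify_le V))
          ((norm_fourierMul_le _).trans (norm_resolventSymbol_le hc)) (norm_nonneg _)
          (norm_nonneg _)
      _ < 1 := by
        rw [← div_eq_mul_inv, div_lt_one hc]
        exact lt_add_one _
  obtain ⟨K, hKpos, hKinj, hK⟩ := exists_perturbed_resolvent hR₀ hinj hW hlt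
  obtain ⟨U, v, hUc, hU0, hvc, hU⟩ := exists_semigroup_orbit hKpos hKinj (ofRealL2 n u₀)
  have hexp : Continuous fun t : ℝ => Real.exp (c * t) := by fun_prop
  have hexpd : ∀ t : ℝ, HasDerivAt (fun t : ℝ => Real.exp (c * t)) (c * Real.exp (c * t)) t := by
    intro t
    have := ((hasDerivAt_id t).const_mul c).exp
    rw [mul_one, mul_comm] at this
    exact this
  -- The orbit `U` solves the equation with `V` replaced by `c + V`; the exponential removes the
  -- shift.
  let u : ℝ → L2 n := fun t => reL2 n (Real.exp (c * t) • U t)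
  let u' : ℝ → L2 n := fun t =>
    reL2 n (Real.exp (c * t) • v t + (c * Real.exp (c * t)) • U t)
  have hu : ∀ t, 0 < t → HasDerivAt u (u' t) t := fun t ht =>
    (reL2 n).hasFDerivAt.comp_hasDerivAt t ((hexpd t).smul (hU t ht).1)
  have hu'c : ContinuousOn u' (Ioi 0) := by
    refine (reL2 n).continuous.comp_continuousOn ((hexp.continuousOn.smul hvc).add ?_)
    exact (continuous_const.mul hexp).continuousOn.smul (hUc.mono Ioi_subset_Ici_self)
  -- Here `y = (c - Δ + V)(exp(ct) U)`, continuous in `L²`. Hence `exp(ct) U = (c - Δ)⁻¹ K y` is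
  -- continuous in `H²`.
  let y : ℝ → ComplexL2 n := fun t => -(Real.exp (c * t) • v t)
  have hyc : ContinuousOn y (Ioi 0) := (hexp.continuousOn.smul hvc).neg
  have hKy : ∀ t, 0 < t → R₀ (K (y t)) = Real.exp (c * t) • U t := by
    intro t ht
    have h1 := (hU t ht).2
    change (R₀ * K) (y t) = _
    rw [map_neg, ContinuousLinearMap.map_smul_of_tower, h1, smul_neg, neg_neg]
  refine ⟨u, ?_, ?_, ⟨fun t => resolventH2 n hc (K (y t)),
    (continuous_resolventH2 hc).comp_continuousOn (K.continuous.comp_continuousOn hyc),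
    fun t ht => ⟨?_, ?_⟩⟩, ?_⟩
  · exact (reL2 n).continuous.comp_continuousOn (hexp.continuousOn.smul hUc)
  · rw [show (1 : WithTop ℕ∞) = 0 + 1 from (zero_add 1).symm,
      contDiffOn_succ_iff_deriv_of_isOpen isOpen_Ioi]
    refine ⟨fun t ht => (hu t ht).differentiableAt.differentiableWithinAt, by simp, ?_⟩
    exact contDiffOn_zero.2 (hu'c.congr fun t ht => (hu t ht).deriv)
  · rw [toL2_resolventH2, ← show R₀ = fourierMul (resolventSymbol hc) from rfl, hKy t ht]
  · have key : deriv u t - SobolevH2.laplacian (resolventH2 n hc (K (y t))) +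
        mulLp volume V (u t) = 0 := by
      rw [(hu t ht).deriv, laplacian_resolventH2,
        ← show R₀ = fourierMul (resolventSymbol hc) from rfl, hKy t ht, ← reL2_mulLp_complexify,
        ← map_sub, ← map_add, ← map_zero (reL2 n)]
      congr 1
      have h1 := hK (y t)
      rw [hKy t ht] at h1
      have h2 : mulLp volume (complexify V) (Real.exp (c * t) • U t) = y t - K (y t) :=
        eq_sub_of_add_eq' h1
      have h3 : (c : ℂ) • Real.exp (c * t) • U t = (c * Real.exp (c * t)) • U t := by
        rw [mul_smul]
        exact Complex.coe_smul c (Real.exp (c * t) • U t)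
      rw [h2, h3]
      simp only [y]
      abel
    have h0 := Lp.coeFn_zero ℝ 2 (volume : Measure (EuclideanSpace ℝ (Fin n)))
    rw [← key] at h0
    filter_upwards [h0, Lp.coeFn_add (deriv u t - SobolevH2.laplacian
      (resolventH2 n hc (K (y t)))) (mulLp volume V (u t)), Lp.coeFn_sub (deriv u t)
      (SobolevH2.laplacian (resolventH2 n hc (K (y t)))), mulLp_ae V (u t)] with x h1 h2 h3 h4
    rw [h1, Pi.add_apply, h3, Pi.sub_apply, h4] at h2
    exact h2.symm
  · change reL2 n (Real.exp (c * 0) • U 0) = u₀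
    rw [mul_zero, Real.exp_zero, one_smul, hU0, reL2_ofRealL2]

end Existence

/-! ### Energy estimates, uniqueness and the weighted inequality -/

section Solution

variable {n : ℕ} {V : EuclideanSpace ℝ (Fin n) →ᵇ ℝ} {u₀ : L2 n} {u v : ℝ → L2 n}

theorem IsHeatSolution.hasDerivAt (h : IsHeatSolution V u₀ u) {t : ℝ} (ht : 0 < t) :
    HasDerivAt u (deriv u t) t :=
  ((h.contDiffOn.differentiableOn one_ne_zero).differentiableAt (Ioi_mem_nhds ht)).hasDerivAt

theorem IsHeatSolution.exists_deriv_eq (h : IsHeatSolution V u₀ u) {t : ℝ} (ht : 0 < t) :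
    ∃ w : SobolevH2 n, SobolevH2.toL2 w = u t ∧
      deriv u t = SobolevH2.laplacian w - mulLp volume V (u t) := by
  obtain ⟨w, -, hw⟩ := h.equation
  refine ⟨w t, (hw t ht).1, Lp.ext ?_⟩
  filter_upwards [(hw t ht).2, Lp.coeFn_sub (SobolevH2.laplacian (w t)) (mulLp volume V (u t)),
    mulLp_ae V (u t)] with x h1 h2 h3
  rw [h2, Pi.sub_apply, h3]
  linarith

theorem IsHeatSolution.inner_deriv_comm (h : IsHeatSolution V u₀ u) {s t : ℝ} (hs : 0 < s)
    (ht : 0 < t) : inner ℝ (deriv u s) (u t) = inner ℝ (u s) (deriv u t) := by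
  obtain ⟨w, hw, hw'⟩ := h.exists_deriv_eq hs
  obtain ⟨z, hz, hz'⟩ := h.exists_deriv_eq ht
  rw [hw', hz', inner_sub_left, inner_sub_right, ← isSymmetric_mulLp (fun _ => rfl), ← hw, ← hz,
    SobolevH2.inner_laplacian_comm]

/-- Pairing the equation with `u` leaves the nonnegative term `‖∇u‖²`, which is dropped. -/
theorem IsHeatSolution.inner_mulLp_le (h : IsHeatSolution V u₀ u) {t : ℝ} (ht : 0 < t) :
    inner ℝ (mulLp volume V (u t)) (u t) ≤ -inner ℝ (deriv u t) (u t) := by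
  obtain ⟨w, hw, hw'⟩ := h.exists_deriv_eq ht
  rw [hw', inner_sub_left, ← hw]
  linarith [SobolevH2.inner_laplacian_self_nonpos w]

theorem IsHeatSolution.antitoneOn_norm_sq (h : IsHeatSolution V u₀ u) (hV : ∀ x, 0 ≤ V x) :
    AntitoneOn (fun t => ‖u t‖ ^ 2) (Ici 0) :=
  _root_.antitoneOn_norm_sq h.continuousOn (fun _ ht => h.hasDerivAt ht) fun t ht => by
    have h1 := h.inner_mulLp_le ht
    have h2 := re_inner_mulLp_self_nonneg (g := V) (G := V) (fun _ => rfl) hV (u t)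
    rw [RCLike.re_to_real] at h2
    linarith

theorem IsHeatSolution.sub (hu : IsHeatSolution V u₀ u) (hv : IsHeatSolution V u₀ v) :
    IsHeatSolution V 0 (u - v) := by
  obtain ⟨w, hwc, hw⟩ := hu.equation
  obtain ⟨z, hzc, hz⟩ := hv.equation
  refine ⟨hu.continuousOn.sub hv.continuousOn, hu.contDiffOn.sub hv.contDiffOn,
    ⟨fun t => w t - z t, hwc.sub hzc, fun t ht => ⟨?_, ?_⟩⟩, ?_⟩
  · rw [Pi.sub_apply, ← (hw t ht).1, ← (hz t ht).1]
    rfl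
  · have h1 : deriv (u - v) t = deriv u t - deriv v t :=
      ((hu.hasDerivAt ht).sub (hv.hasDerivAt ht)).deriv
    have h2 : SobolevH2.laplacian (w t - z t) =
        SobolevH2.laplacian (w t) - SobolevH2.laplacian (z t) := by
      simp only [SobolevH2.laplacian, ← Finset.sum_sub_distrib]
      rfl
    rw [h1, h2, Pi.sub_apply]
    filter_upwards [(hw t ht).2, (hz t ht).2, Lp.coeFn_sub (deriv u t) (deriv v t),
      Lp.coeFn_sub (SobolevH2.laplacian (w t)) (SobolevH2.laplacian (z t)),
      Lp.coeFn_sub (u t) (v t)] with x h1 h2 h3 h4 h5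
    rw [h3, h4, h5, Pi.sub_apply, Pi.sub_apply, Pi.sub_apply]
    linarith
  · rw [Pi.sub_apply, hu.initial, hv.initial, sub_self]

theorem IsHeatSolution.unique (hV : ∀ x, 0 ≤ V x) (hu : IsHeatSolution V u₀ u)
    (hv : IsHeatSolution V u₀ v) {t : ℝ} (ht : 0 ≤ t) : u t = v t := by
  have h1 := (hu.sub hv).antitoneOn_norm_sq hV (mem_Ici.2 le_rfl) (mem_Ici.2 ht) ht
  beta_reduce at h1
  rw [(hu.sub hv).initial, norm_zero, Pi.sub_apply] at h1
  have h2 : ‖u t - v t‖ = 0 := by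
    have := norm_nonneg (u t - v t)
    nlinarith
  exact sub_eq_zero.1 (norm_eq_zero.1 h2)

theorem ae_eq_zero_of_essSupport_subset {f : EuclideanSpace ℝ (Fin n) → ℝ}
    {Ω : Set (EuclideanSpace ℝ (Fin n))} (h : essSupport f ⊆ Ω) : ∀ᵐ x, x ∉ Ω → f x = 0 := by
  have hnull : volume (Ωᶜ ∩ {x | f x ≠ 0}) = 0 := by
    refine measure_null_of_locally_null _ fun x hx => ?_
    have hx' : x ∉ essSupport f := fun hmem => hx.1 (h hmem)
    simp only [essSupport, mem_ofPred_eq, not_forall, not_not] at hx'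
    obtain ⟨U, hU, hU0⟩ := hx'
    obtain ⟨O, hOU, hO, hxO⟩ := mem_nhds_iff.1 hU
    refine ⟨O ∩ {x | f x ≠ 0}, ?_, ?_⟩
    · refine mem_nhdsWithin.2 ⟨O, hO, hxO, fun z hz => ⟨hz.1, hz.2.2⟩⟩
    · have h1 := ae_restrict_of_ae_restrict_of_subset hOU hU0
      rw [ae_restrict_iff' hO.measurableSet] at h1
      rw [ae_iff] at h1
      convert h1 using 2
      ext z
      simp
  rw [← compl_mem_ae_iff] at hnull
  filter_upwards [hnull] with x hx hxΩ
  by_contra hne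
  exact hx ⟨hxΩ, hne⟩

/-- The weighted Young inequality behind the decay estimate. -/
theorem two_mul_inner_le_weighted {Ω : Set (EuclideanSpace ℝ (Fin n))} (hΩ : MeasurableSet Ω)
    (hpos : ∀ x ∈ Ω, 0 < V x) (hV : ∀ x, 0 ≤ V x) (h0 : ∀ᵐ x, x ∉ Ω → u₀ x = 0)
    (hint : IntegrableOn (fun x => |u₀ x| ^ 2 / V x) Ω) {η : ℝ} (hη : 0 < η) (f : L2 n) :
    2 * inner ℝ u₀ f ≤
      (∫ x in Ω, |u₀ x| ^ 2 / V x) / η + η * inner ℝ (mulLp volume V f) f := by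
  have hVf : Integrable fun x => mulLp volume V f x * f x :=
    (Lp.memLp (mulLp volume V f)).integrable_mul (q := 2) (Lp.memLp f)
  have huf : Integrable fun x => u₀ x * f x :=
    (Lp.memLp u₀).integrable_mul (q := 2) (Lp.memLp f)
  have e1 : inner ℝ u₀ f = ∫ x in Ω, u₀ x * f x := by
    rw [L2.inner_def, setIntegral_eq_integral_of_ae_compl_eq_zero]
    · refine integral_congr_ae (Eventually.of_forall fun x => ?_)
      simp [mul_comm]
    · filter_upwards [h0] with x hx hxΩ
      rw [hx hxΩ, zero_mul]
  have e2 : inner ℝ (mulLp volume V f) f = ∫ x, mulLp volume V f x * f x := by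
    rw [L2.inner_def]
    refine integral_congr_ae (Eventually.of_forall fun x => ?_)
    simp [mul_comm]
  -- Since `V ≥ 0` everywhere, the potential energy over `Ω` is at most the total one.
  have e3 : ∫ x in Ω, mulLp volume V f x * f x ≤ ∫ x, mulLp volume V f x * f x := by
    refine setIntegral_le_integral hVf ?_
    filter_upwards [mulLp_ae V f] with x hx
    rw [Pi.zero_apply, hx, mul_assoc]
    exact mul_nonneg (hV x) (mul_self_nonneg _)
  have e4 : ∫ x in Ω, 2 * (u₀ x * f x) ≤
      ∫ x in Ω, ((|u₀ x| ^ 2 / V x) / η + η * (mulLp volume V f x * f x)) := by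
    refine setIntegral_mono_ae_restrict ((huf.const_mul 2).integrableOn)
      ((hint.div_const η).add (hVf.const_mul η).integrableOn) ?_
    rw [EventuallyLE, ae_restrict_iff' hΩ]
    filter_upwards [mulLp_ae V f] with x hx hxΩ
    rw [hx, sq_abs]
    have hp := hpos x hxΩ
    have h1 : u₀ x ^ 2 / V x / η + η * (V x * f x * f x) - 2 * (u₀ x * f x) =
        (u₀ x - η * V x * f x) ^ 2 / (V x * η) := by
      field_simp
      ring
    have h2 : 0 ≤ (u₀ x - η * V x * f x) ^ 2 / (V x * η) := by positivity
    linarith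
  rw [integral_const_mul, integral_add (hint.div_const η) (hVf.const_mul η).integrableOn,
    integral_div, integral_const_mul] at e4
  rw [e1, e2]
  have := mul_le_mul_of_nonneg_left e3 hη.le
  linarith

end Solution

/-! ### The main theorem -/

theorem theorem1p6 :
    ∃ C : ℝ, 0 < C ∧
      ∀ (n : ℕ), 1 ≤ n → ∀ (Ω : Set (EuclideanSpace ℝ (Fin n))), IsOpen Ω →
        ∀ (V : EuclideanSpace ℝ (Fin n) →ᵇ ℝ), (∀ x ∈ Ω, 0 < V x) → (∀ x, 0 ≤ V x) →
        ∀ (u₀ : L2 n), essSupport u₀ ⊆ Ω →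
        IntegrableOn (fun x => |u₀ x| ^ 2 / V x) Ω →
        ∃ u : ℝ → L2 n, IsHeatSolution V u₀ u ∧
          (∀ v : ℝ → L2 n, IsHeatSolution V u₀ v → ∀ t : ℝ, 0 ≤ t → v t = u t) ∧
          ∀ t : ℝ, 0 ≤ t →
            (1 + t) * ‖u t‖ ^ 2 ≤ C * (‖u₀‖ ^ 2 + ∫ x in Ω, |u₀ x| ^ 2 / V x) := by
  refine ⟨1, one_pos, fun n _ Ω hΩ V hpos hV u₀ hsupp hint => ?_⟩
  obtain ⟨u, hu⟩ := exists_isHeatSolution V hV u₀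
  refine ⟨u, hu, fun v hv t ht => hv.unique hV hu ht, fun t ht => ?_⟩
  have h0 := ae_eq_zero_of_essSupport_subset hsupp
  have hJ : 0 ≤ ∫ x in Ω, |u₀ x| ^ 2 / V x :=
    integral_nonneg fun x => div_nonneg (sq_nonneg _) (hV x)
  have hmono : ‖u t‖ ^ 2 ≤ ‖u₀‖ ^ 2 := by
    have := hu.antitoneOn_norm_sq hV (mem_Ici.2 le_rfl) (mem_Ici.2 ht) ht
    beta_reduce at this
    rwa [hu.initial] at this
  rcases ht.eq_or_lt with rfl | ht
  · linarith
  have hdecay : t * ‖u t‖ ^ 2 ≤ (∫ x in Ω, |u₀ x| ^ 2 / V x) / 2 := by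
    refine mul_norm_sq_le_of_inner_initial_le hu.continuousOn (fun s hs => hu.hasDerivAt hs)
      (fun s r hs hr => hu.inner_deriv_comm hs hr) (fun s η hs hη => ?_) ht
    rw [hu.initial]
    refine (two_mul_inner_le_weighted hΩ.measurableSet hpos hV h0 hint hη (u s)).trans ?_
    exact add_le_add_right (mul_le_mul_of_nonneg_left (hu.inner_mulLp_le hs) hη.le) _
  linarith
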